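/- Let $0<\alpha<2$, $J\ge 1$, and for $j=1,\dots,J$ let $\pi_j>0$, $\beta_j\in[-1,1]$ and let $(d_{j,k})_{k\in\mathbb Z}$ be a real sequence that is not identically zero, such that $\sum_k|d_{j,k}|^s<\infty$ for some $s\in(0,\alpha)\cap[0,1]$ if $\alpha\ne1$ or $\beta_j=0$, and $\sum_k|d_{j,k}|\,\big|\ln|d_{j,k}|\big|<\infty$ if $\alpha=1$ and $\beta_j\ne0$. Let $(\varepsilon_{j,t})_{t\in\mathbb Z}$, $j=1,\dots,J$, be mutually independent i.i.d. sequences with stable law $\mathcal S(\alpha,\beta_j,1,0)$, that is $$\mathbb E\, e^{iu\varepsilon_{j,t}}=\exp\{-|u|^\alpha(1-i\beta_j\,\mathrm{sign}(u)\,w(\alpha,u))\},\qquad w(\alpha,u)=\tan(\pi\alpha/2)\ (\alpha\ne1),\quad w(1,u)=-\tfrac2\pi\ln|u| .$$ Let $X_{j,t}=\sum_{k\in\mathbb Z}d_{j,k}\varepsilon_{j,t+k}$ (almost surely unconditionally convergent series; the latent moving averages) and $X_t=\sum_{j=1}^J\pi_jX_{j,t}$ (the stable aggregate). For $m\ge0$,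 $h\ge1$ put $$\boldsymbol X_t=(X_{t-m},\dots,X_t,X_{t+1},\dots,X_{t+h}),\qquad \boldsymbol d_{j,k}=(d_{j,k+m},\dots,d_{j,k},d_{j,k-1},\dots,d_{j,k-h}).$$ *Definitions.* A past semi-norm on $\mathbb R^{m+h+1}$ is a semi-norm with $\|(x_{-m},\dots,x_h)\|=0\iff x_{-m}=\dots=x_0=0$; its unit cylinder is $C^{\|\cdot\|}=\{s:\|s\|=1\}$. A random vector $\boldsymbol X$ is symmetric if $\boldsymbol X\overset d=-\boldsymbol X$ (S1S when it is moreover $1$-stable). A spectral representation of a vector $\boldsymbol X$ on $C^{\|\cdot\|}$ is a pair $(\Gamma',\mu')$ of a Borel measure on $C^{\|\cdot\|}$ and a vector such that: - if $\boldsymbol X$ is not symmetric, for all $u$, $\int|\langle u,s\rangle|^\alpha\,\Gamma'(ds)<\infty$ (if $\alpha\neq1$), resp. $\int|\langle u,s\rangle|\,\big|\ln|\langle u,s\rangle|\big|\,\Gamma'(ds)<\infty$ (if $\alpha=1$), and $$\mathbb E\,e^{i\langle u,\boldsymbol X\rangle}=\exp\Big\{-\int|\langle u,s\rangle|^\alpha\big(1-i\,\mathrm{sign}(\langle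 u,s\rangle)\,w(\alpha,\langle u,s\rangle)\big)\Gamma'(ds)+i\langle u,\mu'\rangle\Big\};$$ - if $\boldsymbol X$ is symmetric, $\Gamma'$ is symmetric, $\mu'=0$, and for all $u$, $\int|\langle u,s\rangle|^\alpha\,\Gamma'(ds)<\infty$ and $\mathbb E\,e^{i\langle u,\boldsymbol X\rangle}=\exp\{-\int|\langle u,s\rangle|^\alpha\,\Gamma'(ds)\}$. A process is $(m,h)$-past-representable if its paths $\boldsymbol X_t$ have a spectral representation on $C^{\|\cdot\|}$ for some past semi-norm on $\mathbb R^{m+h+1}$, and past-representable if it is $(m,h)$-past-representable for some $m\ge0$, $h\ge1$. Let $m_{0,j}\in\mathbb N\cup\{\infty\}$ be the supremum (zero if the set is empty) of the set of $m\ge1$ such that $d_{j,k+m}=\dots=d_{j,k+1}=0$ and $d_{j,k}\ne0$ for some $k\in\mathbb Z$. For a past semi-norm $\|\cdot\|$, the log-summability condition for the sequence $(d_{j,k})_k$ is $$\sum_{k\in\mathbb Z}\|\boldsymbol d_{j,k}\|_e\,\Big|\ln\big(\|\boldsymbol d_{j,k}\|/\|\boldsymbol d_{j,k}\|_e\big)\Big|<\infty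 ,$$ where $\|\cdot\|_e$ is the Euclidean norm, terms with $\boldsymbol d_{j,k}=0$ are zero, and $|\ln 0|=\infty$. *Proposition.* (i)(a) Let $\alpha\ne1$. Then $(X_t)$ is past-representable if and only if every $(X_{j,t})$, $j=1,\dots,J$, is past-representable, and if and only if $\sup_jm_{0,j}<\infty$. Moreover, for $m\ge0$, $h\ge1$, $(X_t)$ is $(m,h)$-past-representable if and only if $\sup_jm_{0,j}<\infty$ and $m\ge\max_jm_{0,j}$. (i)(b) Let $\alpha=1$, and choose any past semi-norm on each $\mathbb R^{m+h+1}$. Then $(X_t)$ is past-representable if and only if $\sup_jm_{0,j}<\infty$ and there is a pair $(m,h)$, $m\ge\max_jm_{0,j}$, $h\ge1$, such that either $\boldsymbol X_t$ is S1S, or $\boldsymbol X_t$ is not symmetric and the log-summability condition holds for all the sequences $(d_{j,k})_k$, $j=1,\dots,J$. For every such pair, $(X_t)$ is $(m,h)$-past-representable. (ii) Let $(X_t)$ be $(m,h)$-past-representable, $m\ge0$, $h\ge1$, and let $\|\cdot\|$ be any past semi-norm on $\mathbb R^{m+h+1}$. Then $\boldsymbol X_t$ has exactly one spectral representation on $C^{\|\cdot\|}$,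 namely $(\Gamma^{\|\cdot\|},\mu^{\|\cdot\|})$ with $$\Gamma^{\|\cdot\|}=\sum_{j=1}^J\sum_{\vartheta\in\{-1,1\}}\sum_{k\in\mathbb Z}\frac{1+\vartheta\beta_j}2\,\pi_j^\alpha\,\|\boldsymbol d_{j,k}\|^\alpha\,\delta_{\vartheta\boldsymbol d_{j,k}/\|\boldsymbol d_{j,k}\|},\qquad \mu^{\|\cdot\|}=-\mathbf 1_{\{\alpha=1\}}\frac2\pi\sum_{j=1}^J\sum_{k\in\mathbb Z}\pi_j\beta_j\,\boldsymbol d_{j,k}\ln\|\pi_j\boldsymbol d_{j,k}\| ,$$ where terms with $\boldsymbol d_{j,k}=0$ vanish. The series in $\mu^{\|\cdot\|}$ converge absolutely, except possibly if $\alpha=1$ and $\boldsymbol X_t$ is S1S; in that case $\mu^{\|\cdot\|}=0$, and this agrees with the formula whenever the series converge absolutely for every $j$. -/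

import Mathlib

open MeasureTheory ProbabilityTheory
open scoped ENNReal

noncomputable section

namespace StableAgg

/-- The function `w(α, s)`: `tan (π α / 2)` for `α ≠ 1`, and `-(2/π) ln |s|` for `α = 1`. -/
def w (α s : ℝ) : ℝ :=
  if α = 1 then -(2 / Real.pi) * Real.log |s| else Real.tan (Real.pi * α / 2)

/-- The integrand of the stable characteristic exponent, as a function of `x = ⟨u, s⟩`:
`|x|^α (1 - i β sign(x) w(α, x))`. -/
def stableExponent (α β x : ℝ) : ℂ :=
  ((|x| ^ α : ℝ) : ℂ) *
    (1 - Complex.I * ((β * (SignType.sign x : ℝ) * w α x : ℝ) : ℂ))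

/-- The law `ν` on `ℝ` is the stable law `S(α, β, 1, 0)` (scale one, shift zero). -/
def IsStdStableLaw (α β : ℝ) (ν : Measure ℝ) : Prop :=
  ∀ u : ℝ, charFun ν u = Complex.exp (-stableExponent α β u)

/-- Paths of length `m + h + 1` live in this space. Coordinate `i` stands for the time
`t - m + i`: the coordinates `i ≤ m` are the observed ones, the others are the future ones. -/
abbrev PathSpace (m h : ℕ) : Type := EuclideanSpace ℝ (Fin (m + h + 1))

/-- The unit cylinder of a semi-norm. -/
def unitCylinder {m h : ℕ} (N : Seminorm ℝ (PathSpace m h)) : Set (PathSpace m h) :=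
  {s | N s = 1}

/-- Semi-norms which vanish exactly on the vectors whose first `m + 1` (observed)
coordinates are zero. -/
def IsPastSeminorm {m h : ℕ} (N : Seminorm ℝ (PathSpace m h)) : Prop :=
  ∀ x : PathSpace m h, N x = 0 ↔ ∀ i : Fin (m + h + 1), (i : ℕ) ≤ m → x i = 0

/-- A measure on a path space which is invariant under `s ↦ -s`. Applied to the law of a random
vector this says that the vector is symmetric. -/
def IsSymm {m h : ℕ} (ν : Measure (PathSpace m h)) : Prop :=
  ν.map (fun s => -s) = ν

/-- `(Γ, b)` is a spectral representation on the unit cylinder of `N` of a random vector with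
law `ν`. A measure on the cylinder is a Borel measure on the whole space that gives mass zero to
the complement. For a symmetric vector `Γ` has to be symmetric and there is no shift. -/
def IsSpectralRep {m h : ℕ} (α : ℝ) (N : Seminorm ℝ (PathSpace m h))
    (ν : Measure (PathSpace m h)) (Γ : Measure (PathSpace m h)) (b : PathSpace m h) : Prop :=
  Γ (unitCylinder N)ᶜ = 0 ∧
  (IsSymm ν →
    IsSymm Γ ∧ b = 0 ∧
    (∀ u : PathSpace m h, Integrable (fun s => |inner ℝ u s| ^ α) Γ) ∧
    (∀ u : PathSpace m h,
      charFun ν u = Complex.exp (-((∫ s, |inner ℝ u s| ^ α ∂Γ : ℝ) : ℂ)))) ∧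
  (¬ IsSymm ν →
    (α ≠ 1 → ∀ u : PathSpace m h, Integrable (fun s => |inner ℝ u s| ^ α) Γ) ∧
    (α = 1 → ∀ u : PathSpace m h,
      Integrable (fun s => |inner ℝ u s| * |Real.log (|inner ℝ u s|)|) Γ) ∧
    (∀ u : PathSpace m h,
      charFun ν u = Complex.exp
        (-(∫ s, stableExponent α 1 (inner ℝ u s) ∂Γ)
          + Complex.I * ((inner ℝ u b : ℝ) : ℂ))))

/-- A random vector with law `ν` is representable on the unit cylinder of `N`. -/
def IsRepresentable {m h : ℕ} (α : ℝ) (N : Seminorm ℝ (PathSpace m h))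
    (ν : Measure (PathSpace m h)) : Prop :=
  ∃ (Γ : Measure (PathSpace m h)) (b : PathSpace m h), IsSpectralRep α N ν Γ b

/-- The random vector `(X_{t-m}, …, X_t, X_{t+1}, …, X_{t+h})`. -/
def path {Ω : Type*} (X : ℤ → Ω → ℝ) (m h : ℕ) (t : ℤ) (ω : Ω) : PathSpace m h :=
  WithLp.toLp 2 (fun i : Fin (m + h + 1) => X (t - (m : ℤ) + ((i : ℕ) : ℤ)) ω)

/-- The law of the path `(X_{t-m}, …, X_{t+h})`. -/
def pathLaw {Ω : Type*} [MeasurableSpace Ω] (μ : Measure Ω) (X : ℤ → Ω → ℝ)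
    (m h : ℕ) (t : ℤ) : Measure (PathSpace m h) :=
  μ.map (path X m h t)

/-- `(m, h)`-past-representability of a process. -/
def IsPastRepresentableAt {Ω : Type*} [MeasurableSpace Ω] (μ : Measure Ω) (α : ℝ)
    (X : ℤ → Ω → ℝ) (m h : ℕ) : Prop :=
  ∃ N : Seminorm ℝ (PathSpace m h), IsPastSeminorm N ∧
    ∀ t : ℤ, IsRepresentable α N (pathLaw μ X m h t)

/-- Past-representability of a process. -/
def IsPastRepresentable {Ω : Type*} [MeasurableSpace Ω] (μ : Measure Ω) (α : ℝ)
    (X : ℤ → Ω → ℝ) : Prop :=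
  ∃ m h : ℕ, 1 ≤ h ∧ IsPastRepresentableAt μ α X m h

/-- The standing conditions on the coefficients of a moving average. -/
structure CoeffCondition (α β : ℝ) (d : ℤ → ℝ) : Prop where
  ne_zero : ∃ k, d k ≠ 0
  summable_rpow : (α ≠ 1 ∨ β = 0) →
    ∃ s : ℝ, 0 < s ∧ s < α ∧ s ≤ 1 ∧ Summable (fun k => |d k| ^ s)
  summable_log : α = 1 → β ≠ 0 → Summable (fun k => |d k| * |Real.log (|d k|)|)

/-- `X_t = ∑_k d_k ε_{t+k}`, the series being almost surely (unconditionally) convergent. -/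
def IsMovingAverage {Ω : Type*} [MeasurableSpace Ω] (μ : Measure Ω)
    (d : ℤ → ℝ) (ε X : ℤ → Ω → ℝ) : Prop :=
  ∀ t : ℤ, ∀ᵐ ω ∂μ, HasSum (fun k : ℤ => d k * ε (t + k) ω) (X t ω)

/-- `X` is the stable aggregate `X_t = ∑_j p_j X_{j,t}` of the latent moving averages `L j`,
with coefficients `d j` and errors `ε j`: the error sequences are mutually independent, and
each of them is i.i.d. with law `S(α, β_j, 1, 0)`. -/
structure IsStableAggregate {Ω : Type*} [MeasurableSpace Ω] (μ : Measure Ω) {J : ℕ}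
    (α : ℝ) (β p : Fin J → ℝ) (d : Fin J → ℤ → ℝ) (ε L : Fin J → ℤ → Ω → ℝ)
    (X : ℤ → Ω → ℝ) : Prop where
  skewness : ∀ j, β j ∈ Set.Icc (-1 : ℝ) 1
  weight_pos : ∀ j, 0 < p j
  coeff : ∀ j, CoeffCondition α (β j) (d j)
  measurable : ∀ j t, Measurable (ε j t)
  indep : iIndepFun (fun q : Fin J × ℤ => ε q.1 q.2) μ
  law : ∀ j t, IsStdStableLaw α (β j) (μ.map (ε j t))
  latent : ∀ j, IsMovingAverage μ (d j) (ε j) (L j)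
  aggregate : ∀ t, ∀ᵐ ω ∂μ, X t ω = ∑ j, p j * L j t ω

/-- The set of lengths `m ≥ 1` such that `d_{k+m} = … = d_{k+1} = 0` and `d_k ≠ 0`
for some `k`. -/
def zeroRuns (d : ℤ → ℝ) : Set ℕ :=
  {m | 1 ≤ m ∧ ∃ k : ℤ, (∀ i : ℕ, 1 ≤ i → i ≤ m → d (k + i) = 0) ∧ d k ≠ 0}

/-- The supremum of `zeroRuns d` in `ℕ ∪ {∞}`; it is zero when that set is empty. -/
def m₀ (d : ℤ → ℝ) : ℕ∞ := ⨆ m ∈ zeroRuns d, (m : ℕ∞)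

/-- The vector `(d_{k+m}, …, d_k, d_{k-1}, …, d_{k-h})`. -/
def coeffVec (d : ℤ → ℝ) (m h : ℕ) (k : ℤ) : PathSpace m h :=
  WithLp.toLp 2 (fun i : Fin (m + h + 1) => d (k + (m : ℤ) - ((i : ℕ) : ℤ)))

/-- `∑_k ‖d_k‖_e |ln (N(d_k) / ‖d_k‖_e)| < ∞`, where the term of a vector `d_k = 0` is zero and
`|ln 0| = ∞`, which the first conjunct expresses. -/
def LogSummable {m h : ℕ} (N : Seminorm ℝ (PathSpace m h)) (d : ℤ → ℝ) : Prop :=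
  (∀ k, N (coeffVec d m h k) = 0 → coeffVec d m h k = 0) ∧
  Summable (fun k : ℤ =>
    ‖coeffVec d m h k‖ * |Real.log (N (coeffVec d m h k) / ‖coeffVec d m h k‖)|)

/-- The measure `∑_j ∑_{θ = ±1} ∑_k ((1 + θ β_j) / 2) p_j^α N(d_{j,k})^α δ_{θ d_{j,k} / N(d_{j,k})}`;
the terms with `N(d_{j,k}) = 0` vanish. -/
def cylinderMeasure {m h J : ℕ} (α : ℝ) (β p : Fin J → ℝ) (d : Fin J → ℤ → ℝ)
    (N : Seminorm ℝ (PathSpace m h)) : Measure (PathSpace m h) :=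
  ∑ j : Fin J, ∑ θ ∈ ({1, -1} : Finset ℝ), Measure.sum (fun k : ℤ =>
    ENNReal.ofReal ((1 + θ * β j) / 2 * p j ^ α * N (coeffVec (d j) m h k) ^ α) •
      Measure.dirac ((θ / N (coeffVec (d j) m h k)) • coeffVec (d j) m h k))

/-- The term `-1_{α = 1} (2/π) p_j β_j d_{j,k} ln N(p_j d_{j,k})` of the shift vector. -/
def shiftTerm {m h J : ℕ} (α : ℝ) (β p : Fin J → ℝ) (d : Fin J → ℤ → ℝ)
    (N : Seminorm ℝ (PathSpace m h)) (j : Fin J) (k : ℤ) : PathSpace m h :=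
  (if α = 1 then
      -(2 / Real.pi) * (p j * β j * Real.log (N (p j • coeffVec (d j) m h k)))
    else 0) • coeffVec (d j) m h k

/-- The shift vector `-1_{α = 1} (2/π) ∑_j ∑_k p_j β_j d_{j,k} ln N(p_j d_{j,k})`. -/
def cylinderShift {m h J : ℕ} (α : ℝ) (β p : Fin J → ℝ) (d : Fin J → ℤ → ℝ)
    (N : Seminorm ℝ (PathSpace m h)) : PathSpace m h :=
  ∑ j : Fin J, ∑' k : ℤ, shiftTerm α β p d N j k

end StableAgg

end

/-
The symmetric second difference `2 F u - F (u + v) - F (u - v)` of a stable exponent `F` is, up to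
constants, the Fourier transform of the Lévy measure weighted by `1 - cos ⟪v, x⟫`. Hence the
exponent determines the Lévy measure away from the origin, and the tail of the Lévy measure on
`{1 < N}`, in polar coordinates for the semi-norm `N`, determines the spectral measure on the unit
cylinder. For a path of the aggregate the exponent is the one of the discrete measure carried by the
points `± π_j d_{j,k}`, so a representation on the cylinder can only be the radial projection of
that measure. It exists as soon as no atom other than `0` lies in the kernel of `N`, which for a
past semi-norm means that `m` is at least the length of every run of zeros; when `α = 1`, moving
mass along rays also shifts the location by a logarithmic moment, which has to be finite unless
symmetry makes it cancel.
-/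

noncomputable section

open Set Filter Topology Real
open scoped InnerProductSpace

namespace StableAgg

/-- The measure `r ^ (-1 - α) dr` on the positive half-line, the radial part of the Lévy measure of
an `α`-stable law. -/
def rayMeasure (α : ℝ) : Measure ℝ :=
  (volume.restrict (Ioi 0)).withDensity (fun r => ENNReal.ofReal (r ^ (-1 - α)))

section RayMeasure

variable {α : ℝ} {E : Type*} [NormedAddCommGroup E] [NormedSpace ℝ E]

instance : SFinite (rayMeasure α) := by unfold rayMeasure; infer_instance

lemma ae_rayMeasure_pos : ∀ᵐ r ∂(rayMeasure α), 0 < r :=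
  (withDensity_absolutelyContinuous _ _).ae_le (self_mem_ae_restrict measurableSet_Ioi)

lemma integrable_rayMeasure_iff {f : ℝ → E} :
    Integrable f (rayMeasure α) ↔ IntegrableOn (fun r => r ^ (-1 - α) • f r) (Ioi 0) := by
  rw [rayMeasure, integrable_withDensity_iff_integrable_smul' (by fun_prop) (by simp)]
  refine integrable_congr ?_
  filter_upwards [self_mem_ae_restrict measurableSet_Ioi] with r hr
  rw [ENNReal.toReal_ofReal (rpow_nonneg (le_of_lt hr) _)]

lemma integral_rayMeasure (f : ℝ → E) :
    ∫ r, f r ∂(rayMeasure α) = ∫ r in Ioi 0, r ^ (-1 - α) • f r := by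
  rw [rayMeasure, integral_withDensity_eq_integral_toReal_smul (by fun_prop) (by simp)]
  refine setIntegral_congr_fun measurableSet_Ioi fun r hr => ?_
  rw [ENNReal.toReal_ofReal (rpow_nonneg (le_of_lt hr) _)]

lemma integral_rayMeasure_comp_mul_left {x : ℝ} (hx : 0 < x) (f : ℝ → E) :
    ∫ r, f (x * r) ∂(rayMeasure α) = x ^ α • ∫ r, f r ∂(rayMeasure α) := by
  have hscale : ∀ r ∈ Ioi (0 : ℝ),
      r ^ (-1 - α) • f (x * r) = x ^ (1 + α) • ((x * r) ^ (-1 - α) • f (x * r)) := by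
    intro r hr
    rw [mul_rpow hx.le (le_of_lt hr), smul_smul, ← mul_assoc, ← rpow_add hx]
    simp
  rw [integral_rayMeasure, integral_rayMeasure, setIntegral_congr_fun measurableSet_Ioi hscale,
    integral_smul, integral_comp_mul_left_Ioi (fun r => r ^ (-1 - α) • f r) 0 hx, mul_zero,
    smul_smul, rpow_add hx, rpow_one, mul_right_comm, mul_inv_cancel₀ hx.ne', one_mul]

lemma rayMeasure_Ioi (hα₀ : 0 < α) {a : ℝ} (ha : 0 < a) :
    rayMeasure α (Ioi a) = ENNReal.ofReal (a ^ (-α) / α) := by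
  have hnonneg : 0 ≤ᵐ[volume.restrict (Ioi a)] fun r => r ^ (-1 - α) := by
    filter_upwards [self_mem_ae_restrict measurableSet_Ioi] with r hr
    exact rpow_nonneg (ha.trans hr).le _
  rw [rayMeasure, withDensity_apply _ measurableSet_Ioi,
    Measure.restrict_restrict measurableSet_Ioi, inter_eq_left.2 (Ioi_subset_Ioi ha.le),
    ← ofReal_integral_eq_lintegral_ofReal (integrableOn_Ioi_rpow_of_lt (by linarith) ha) hnonneg,
    integral_Ioi_rpow_of_lt (by linarith) ha]
  ring_nf

lemma integrable_rayMeasure_min_one_sq (hα₀ : 0 < α) (hα₂ : α < 2) :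
    Integrable (fun r : ℝ => min 1 (r ^ 2)) (rayMeasure α) := by
  rw [integrable_rayMeasure_iff, ← Ioc_union_Ioi_eq_Ioi (zero_le_one' ℝ)]
  refine IntegrableOn.union ?_ ?_
  · have hpow : IntegrableOn (fun r : ℝ => r ^ (1 - α)) (Ioc 0 1) := by
      rw [integrableOn_Ioc_iff_integrableOn_Ioo]
      exact (intervalIntegral.integrableOn_Ioo_rpow_iff one_pos).2 (by linarith)
    refine hpow.congr_fun (fun r hr => ?_) measurableSet_Ioc
    rw [min_eq_right (pow_le_one₀ hr.1.le hr.2), smul_eq_mul, ← rpow_natCast, ← rpow_add hr.1]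
    ring_nf
  · have hpow : IntegrableOn (fun r : ℝ => r ^ (-1 - α)) (Ioi 1) :=
      integrableOn_Ioi_rpow_of_lt (by linarith) one_pos
    refine hpow.congr_fun (fun r hr => ?_) measurableSet_Ioi
    rw [min_eq_left (one_le_pow₀ (le_of_lt hr)), smul_eq_mul, mul_one]

end RayMeasure

section TrigonometricIntegrals

variable {α : ℝ}

lemma one_sub_cos_nonneg (x : ℝ) : 0 ≤ 1 - cos x := sub_nonneg.2 (cos_le_one x)

lemma one_sub_cos_mul_le (x r : ℝ) : 1 - cos (x * r) ≤ (x ^ 2 + 2) * min 1 (r ^ 2) := by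
  rw [mul_min_of_nonneg _ _ (by positivity)]
  refine le_min ?_ ?_
  · linarith [neg_one_le_cos (x * r), sq_nonneg x]
  · nlinarith [one_sub_sq_div_two_le_cos (x := x * r), sq_nonneg (x * r), sq_nonneg r]

lemma integrable_one_sub_cos (hα₀ : 0 < α) (hα₂ : α < 2) (x : ℝ) :
    Integrable (fun r => 1 - cos (x * r)) (rayMeasure α) := by
  refine ((integrable_rayMeasure_min_one_sq hα₀ hα₂).const_mul (x ^ 2 + 2)).mono' (by fun_prop)
    (ae_of_all _ fun r => ?_)
  rw [norm_of_nonneg (one_sub_cos_nonneg _)]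
  exact one_sub_cos_mul_le x r

lemma integral_one_sub_cos (hα₀ : 0 < α) (x : ℝ) :
    ∫ r, (1 - cos (x * r)) ∂(rayMeasure α) = |x| ^ α * ∫ r, (1 - cos r) ∂(rayMeasure α) := by
  rcases eq_or_ne x 0 with rfl | hx
  · simp [zero_rpow hα₀.ne']
  · rw [← smul_eq_mul, ← integral_rayMeasure_comp_mul_left (abs_pos.2 hx)]
    rcases abs_choice x with h | h <;> simp [h]

lemma abs_sin_sub_self_le (t : ℝ) : |sin t - t| ≤ 2 * t ^ 2 := by
  wlog ht : 0 ≤ t generalizing t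
  · have hneg := this (-t) (by linarith)
    rwa [sin_neg, neg_sq, ← neg_sub', abs_neg] at hneg
  rcases ht.eq_or_lt with rfl | ht
  · simp
  rw [abs_sub_comm, abs_of_nonneg (sub_nonneg.2 (sin_le ht.le))]
  rcases le_total t 1 with h | h
  · nlinarith [sin_gt_sub_cube ht, mul_nonneg (sq_nonneg t) (sub_nonneg.2 h), sq_nonneg t]
  · nlinarith [neg_one_le_sin t]

lemma abs_sin_mul_sub_le (x r : ℝ) :
    |sin (x * r) - x * sin r| ≤ 2 * (1 + |x|) ^ 2 * min 1 (r ^ 2) := by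
  have hx := abs_nonneg x
  rw [mul_min_of_nonneg _ _ (by positivity)]
  refine le_min ?_ ?_
  · calc |sin (x * r) - x * sin r| ≤ |sin (x * r)| + |x| * |sin r| := by
          rw [← abs_mul]; exact abs_sub _ _
      _ ≤ 1 + |x| * 1 := by gcongr <;> exact abs_sin_le_one _
      _ ≤ 2 * (1 + |x|) ^ 2 * 1 := by nlinarith
  · calc |sin (x * r) - x * sin r| = |(sin (x * r) - x * r) - x * (sin r - r)| := by ring_nf
      _ ≤ |sin (x * r) - x * r| + |x| * |sin r - r| := by rw [← abs_mul]; exact abs_sub _ _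
      _ ≤ 2 * (x * r) ^ 2 + |x| * (2 * r ^ 2) := by gcongr <;> exact abs_sin_sub_self_le _
      _ = 2 * (|x| ^ 2 + |x|) * r ^ 2 := by rw [sq_abs]; ring
      _ ≤ 2 * (1 + |x|) ^ 2 * r ^ 2 := by gcongr; nlinarith

lemma integrable_sin_mul_sub (hα₀ : 0 < α) (hα₂ : α < 2) (x : ℝ) :
    Integrable (fun r => sin (x * r) - x * sin r) (rayMeasure α) :=
  ((integrable_rayMeasure_min_one_sq hα₀ hα₂).const_mul _).mono' (by fun_prop)
    (ae_of_all _ (abs_sin_mul_sub_le x))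

/-- The integral `∫ (sin (x r) - x sin r) r ^ (-1 - α) dr`, the imaginary part of the
Lévy-Khintchine exponent of a totally skewed stable law. Compensating with `sin r`, rather than with
a truncation of `r`, makes it vanish at `x = 1`. -/
def sineIntegral (α x : ℝ) : ℝ := ∫ r, (sin (x * r) - x * sin r) ∂(rayMeasure α)

lemma sineIntegral_neg (x : ℝ) : sineIntegral α (-x) = -sineIntegral α x := by
  rw [sineIntegral, sineIntegral, ← integral_neg]
  congr with r
  rw [neg_mul, sin_neg]
  ring

lemma sineIntegral_zero : sineIntegral α 0 = 0 := by simp [sineIntegral]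

lemma sineIntegral_mul (hα₀ : 0 < α) (hα₂ : α < 2) {x : ℝ} (hx : 0 < x) (y : ℝ) :
    sineIntegral α (x * y) = x ^ α * sineIntegral α y + y * sineIntegral α x := by
  have hy : Integrable (fun r => sin (y * (x * r)) - y * sin (x * r)) (rayMeasure α) := by
    refine (((integrable_sin_mul_sub hα₀ hα₂ (y * x)).sub
      ((integrable_sin_mul_sub hα₀ hα₂ x).const_mul y))).congr (ae_of_all _ fun r => ?_)
    simp only [Pi.sub_apply]
    ring_nf
  have hscale := integral_rayMeasure_comp_mul_left (α := α) hx fun r => sin (y * r) - y * sin r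
  unfold sineIntegral
  rw [← smul_eq_mul (x ^ α), ← hscale, ← integral_const_mul,
    ← integral_add hy ((integrable_sin_mul_sub hα₀ hα₂ x).const_mul y)]
  congr with r
  ring_nf

lemma continuous_sineIntegral (hα₀ : 0 < α) (hα₂ : α < 2) : Continuous (sineIntegral α) := by
  refine continuous_iff_continuousAt.2 fun x₀ => continuousAt_of_dominated
    (bound := fun r => 2 * (1 + (|x₀| + 1)) ^ 2 * min 1 (r ^ 2))
    (Eventually.of_forall fun x => by fun_prop) ?_
    ((integrable_rayMeasure_min_one_sq hα₀ hα₂).const_mul _) (ae_of_all _ fun r => by fun_prop)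
  filter_upwards [continuous_abs.continuousAt.eventually_lt_const (lt_add_one |x₀|)] with x hx
  refine ae_of_all _ fun r => (abs_sin_mul_sub_le x r).trans ?_
  gcongr

end TrigonometricIntegrals

lemma stableExponent_re (α β x : ℝ) : (stableExponent α β x).re = |x| ^ α := by
  simp [stableExponent]

lemma stableExponent_im (α β x : ℝ) :
    (stableExponent α β x).im = -(|x| ^ α * (β * (SignType.sign x : ℝ) * w α x)) := by
  simp [stableExponent]

lemma stableExponent_zero {α : ℝ} (hα₀ : 0 < α) (β : ℝ) : stableExponent α β 0 = 0 := by
  simp [stableExponent, zero_rpow hα₀.ne']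

lemma stableExponent_neg (α β x : ℝ) :
    stableExponent α β (-x) = (starRingEnd ℂ) (stableExponent α β x) := by
  apply Complex.ext
  · simp only [Complex.conj_re, stableExponent_re, abs_neg]
  · rw [Complex.conj_im, stableExponent_im, stableExponent_im]
    simp only [abs_neg, w, Left.sign_neg, SignType.coe_neg]
    ring

lemma tan_pi_mul_div_two_ne_zero {α : ℝ} (hα₀ : 0 < α) (hα₂ : α < 2) (hα : α ≠ 1) :
    tan (π * α / 2) ≠ 0 := by
  have hπ := pi_pos
  have hsin : sin (π * α / 2) ≠ 0 :=
    (sin_pos_of_pos_of_lt_pi (by positivity) (by nlinarith)).ne'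
  have hcos : cos (π * α / 2) ≠ 0 := by
    rcases lt_or_gt_of_ne hα with h | h
    · exact (cos_pos_of_mem_Ioo ⟨by nlinarith, by nlinarith⟩).ne'
    · exact (cos_neg_of_pi_div_two_lt_of_lt (by nlinarith) (by nlinarith)).ne
  rw [tan_eq_sin_div_cos]
  exact div_ne_zero hsin hcos

section SineIntegral

variable {α : ℝ}

lemma exists_sineIntegral_one_eq : ∃ c, ∀ x, 0 < x → sineIntegral 1 x = c * (x * log x) := by
  have hadd (s t : ℝ) : exp (-(s + t)) * sineIntegral 1 (exp (s + t))
      = exp (-s) * sineIntegral 1 (exp s) + exp (-t) * sineIntegral 1 (exp t) := by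
    rw [exp_add, sineIntegral_mul one_pos one_lt_two (exp_pos s), rpow_one, neg_add, exp_add,
      exp_neg, exp_neg]
    field_simp
    ring
  have hcont := continuous_sineIntegral one_pos one_lt_two
  refine ⟨exp (-1) * sineIntegral 1 (exp 1), fun x hx => ?_⟩
  have hlin : x⁻¹ * sineIntegral 1 x = log x * (exp (-1) * sineIntegral 1 (exp 1)) := by
    simpa [exp_neg, exp_log hx] using map_real_smul
      (AddMonoidHom.mk' (fun t => exp (-t) * sineIntegral 1 (exp t)) hadd)
      (show Continuous fun t => exp (-t) * sineIntegral 1 (exp t) by fun_prop) (log x) 1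
  rw [inv_mul_eq_iff_eq_mul₀ hx.ne'] at hlin
  rw [hlin]
  ring

-- The functional equation of `sineIntegral_mul` is symmetric in `x` and `2`.
lemma exists_sineIntegral_eq_of_ne_one (hα₀ : 0 < α) (hα₂ : α < 2) (hα : α ≠ 1) :
    ∃ c, ∀ x, 0 < x → sineIntegral α x = c * (x ^ α - x) := by
  have h2 : (2 : ℝ) ^ α - 2 ≠ 0 := by
    rw [sub_ne_zero]
    nth_rewrite 2 [← rpow_one 2]
    exact fun h => hα ((strictMono_rpow_of_base_gt_one one_lt_two).injective h)
  refine ⟨sineIntegral α 2 / (2 ^ α - 2), fun x hx => ?_⟩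
  have hx2 := sineIntegral_mul hα₀ hα₂ hx 2
  rw [mul_comm, sineIntegral_mul hα₀ hα₂ two_pos x] at hx2
  rw [div_mul_eq_mul_div, eq_div_iff h2]
  linear_combination hx2

lemma exists_sineIntegral_eq (hα₀ : 0 < α) (hα₂ : α < 2) :
    ∃ b c : ℝ, ∀ x, sineIntegral α x = b * (stableExponent α 1 x).im + c * x := by
  suffices h : ∃ b c : ℝ, ∀ x, 0 < x →
      sineIntegral α x = b * (x ^ α * w α x) + c * x by
    obtain ⟨b, c, hpos⟩ := h
    refine ⟨-b, c, fun x => ?_⟩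
    rcases lt_trichotomy x 0 with hx | rfl | hx
    · have hneg := hpos (-x) (neg_pos.2 hx)
      rw [sineIntegral_neg] at hneg
      rw [stableExponent_im, sign_neg hx, abs_of_neg hx, SignType.coe_neg_one]
      simp only [w, abs_neg] at hneg ⊢
      linear_combination -hneg
    · simp [sineIntegral_zero, stableExponent_zero hα₀]
    · rw [hpos x hx, stableExponent_im, sign_pos hx, abs_of_pos hx, SignType.coe_one]
      ring
  by_cases hα : α = 1
  · subst hα
    obtain ⟨c, hc⟩ := exists_sineIntegral_one_eq
    refine ⟨-(π / 2 * c), 0, fun x hx => ?_⟩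
    rw [hc x hx, w, if_pos rfl, abs_of_pos hx, rpow_one]
    field_simp
    ring
  · obtain ⟨c, hc⟩ := exists_sineIntegral_eq_of_ne_one hα₀ hα₂ hα
    refine ⟨c / tan (π * α / 2), -c, fun x hx => ?_⟩
    have htan := tan_pi_mul_div_two_ne_zero hα₀ hα₂ hα
    rw [hc x hx, w, if_neg hα]
    field_simp
    ring

end SineIntegral

/-- The symmetric second difference of `F` at `x` with step `y`. It annihilates linear maps, hence
forgets the shift in the logarithm of a stable characteristic function. -/
def secondDiff {V G : Type*} [AddCommGroup V] [AddCommGroup G] (F : V → G) (x y : V) : G :=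
  F (x + y) + F (x - y) - 2 • F x

section SecondDiff

variable {α : ℝ}

lemma integral_cos_mul_one_sub_cos (hα₀ : 0 < α) (hα₂ : α < 2) (x y : ℝ) :
    ∫ r, cos (x * r) * (1 - cos (y * r)) ∂(rayMeasure α)
      = (∫ r, (1 - cos r) ∂(rayMeasure α)) / 2 * secondDiff (fun t => |t| ^ α) x y := by
  have hsplit (r : ℝ) : cos (x * r) * (1 - cos (y * r)) = (1 - cos ((x + y) * r)) / 2
      + (1 - cos ((x - y) * r)) / 2 - (1 - cos (x * r)) := by
    rw [add_mul, sub_mul, cos_add, cos_sub]; ring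
  have hint (z : ℝ) := integrable_one_sub_cos hα₀ hα₂ z
  have hadd := ((hint (x + y)).div_const 2).add ((hint (x - y)).div_const 2)
  simp_rw [hsplit]
  refine (integral_sub hadd (hint x)).trans ?_
  refine (congrArg (· - _) (integral_add ((hint _).div_const 2) ((hint _).div_const 2))).trans ?_
  simp only [integral_div, integral_one_sub_cos hα₀, secondDiff, nsmul_eq_mul]
  push_cast
  ring

lemma integral_sin_mul_one_sub_cos (hα₀ : 0 < α) (hα₂ : α < 2) (x y : ℝ) :
    ∫ r, sin (x * r) * (1 - cos (y * r)) ∂(rayMeasure α)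
      = -(1 / 2) * secondDiff (sineIntegral α) x y := by
  have hsplit (r : ℝ) : sin (x * r) * (1 - cos (y * r)) = (sin (x * r) - x * sin r)
      - ((sin ((x + y) * r) - (x + y) * sin r) / 2
        + (sin ((x - y) * r) - (x - y) * sin r) / 2) := by
    rw [add_mul x y r, sub_mul x y r, sin_add, sin_sub]; ring
  have hint (z : ℝ) := integrable_sin_mul_sub hα₀ hα₂ z
  have hadd := ((hint (x + y)).div_const 2).add ((hint (x - y)).div_const 2)
  simp_rw [hsplit]
  refine (integral_sub (hint x) hadd).trans ?_
  refine (congrArg (_ - ·) (integral_add ((hint _).div_const 2) ((hint _).div_const 2))).trans ?_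
  simp only [integral_div, secondDiff, nsmul_eq_mul, sineIntegral]
  push_cast
  ring

lemma exists_integral_sin_mul_one_sub_cos (hα₀ : 0 < α) (hα₂ : α < 2) :
    ∃ c : ℝ, ∀ x y, ∫ r, sin (x * r) * (1 - cos (y * r)) ∂(rayMeasure α)
      = c * secondDiff (fun t => (stableExponent α 1 t).im) x y := by
  obtain ⟨b, c, hbc⟩ := exists_sineIntegral_eq hα₀ hα₂
  refine ⟨-(b / 2), fun x y => ?_⟩
  simp only [integral_sin_mul_one_sub_cos hα₀ hα₂, secondDiff, hbc, nsmul_eq_mul]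
  push_cast
  ring

end SecondDiff

/-- The weight `|x| ^ α`, with an additional factor `1 + |log |x||` for `α = 1`. It dominates the
stable exponent, and is monotone in `|x|` and submultiplicative. -/
def growth (α x : ℝ) : ℝ := |x| ^ α * (if α = 1 then 1 + |log x| else 1)

section Growth

variable {α : ℝ}

lemma growth_one (x : ℝ) : growth 1 x = |x| * (1 + |log x|) := by simp [growth]

lemma growth_of_ne_one (hα : α ≠ 1) (x : ℝ) : growth α x = |x| ^ α := by simp [growth, hα]

lemma growth_nonneg (α x : ℝ) : 0 ≤ growth α x := by unfold growth; split_ifs <;> positivity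

lemma measurable_growth (α : ℝ) : Measurable (growth α) := by
  have : Measurable fun x : ℝ => |x| := measurable_id.abs
  have : Measurable fun x : ℝ => |log x| := measurable_log.abs
  unfold growth
  split_ifs <;> fun_prop

lemma abs_rpow_le_growth (α x : ℝ) : |x| ^ α ≤ growth α x := by
  refine le_mul_of_one_le_right (by positivity) ?_
  split_ifs
  · exact le_add_of_nonneg_right (abs_nonneg _)
  · exact le_rfl

lemma mul_one_add_abs_log_le {x y : ℝ} (hx : 0 < x) (hxy : x ≤ y) :
    x * (1 + |log x|) ≤ y * (1 + |log y|) := by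
  have hy : 0 < y := hx.trans_le hxy
  have hlog : |log x| ≤ |log y| + (y / x - 1) := by
    calc |log x| = |log y - log (y / x)| := by rw [log_div hy.ne' hx.ne', sub_sub_cancel]
      _ ≤ |log y| + |log (y / x)| := abs_sub _ _
      _ ≤ |log y| + (y / x - 1) := by
        rw [abs_of_nonneg (log_nonneg ((one_le_div hx).2 hxy))]
        gcongr
        exact log_le_sub_one_of_pos (div_pos hy hx)
  calc x * (1 + |log x|) ≤ x * (1 + (|log y| + (y / x - 1))) := by gcongr
    _ = y + x * |log y| := by field_simp; ring
    _ ≤ y * (1 + |log y|) := by rw [mul_one_add]; gcongr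

lemma growth_le_growth (hα₀ : 0 < α) {x y : ℝ} (hxy : |x| ≤ |y|) : growth α x ≤ growth α y := by
  by_cases hα : α = 1
  · subst hα
    rw [growth_one, growth_one]
    rcases eq_or_ne x 0 with rfl | hx
    · rw [abs_zero, zero_mul]
      positivity
    · simpa only [log_abs] using mul_one_add_abs_log_le (abs_pos.2 hx) hxy
  · rw [growth_of_ne_one hα, growth_of_ne_one hα]
    exact rpow_le_rpow (abs_nonneg _) hxy hα₀.le

lemma growth_mul_le (α x y : ℝ) : growth α (x * y) ≤ growth α x * growth α y := by
  by_cases hα : α = 1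
  · subst hα
    simp only [growth_one, abs_mul]
    rcases eq_or_ne x 0 with rfl | hx
    · simp
    rcases eq_or_ne y 0 with rfl | hy
    · simp
    calc |x| * |y| * (1 + |log (x * y)|) ≤ |x| * |y| * ((1 + |log x|) * (1 + |log y|)) := by
          rw [log_mul hx hy]
          gcongr
          nlinarith [abs_add_le (log x) (log y), abs_nonneg (log x), abs_nonneg (log y)]
      _ = |x| * (1 + |log x|) * (|y| * (1 + |log y|)) := by ring
  · simp only [growth_of_ne_one hα, abs_mul]
    rw [mul_rpow (abs_nonneg _) (abs_nonneg _)]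

end Growth

section StableExponent

variable {α : ℝ}

lemma abs_sign_le_one (x : ℝ) : |(SignType.sign x : ℝ)| ≤ 1 := by
  rcases lt_trichotomy x 0 with h | h | h <;> simp [h]

lemma abs_w_le (α x : ℝ) :
    1 + |w α x| ≤ (1 + |tan (π * α / 2)|) * (if α = 1 then 1 + |log x| else 1) := by
  unfold w
  split_ifs
  · have hπ : |-(2 / π)| ≤ 1 := by
      rw [abs_neg, abs_of_pos (by positivity), div_le_one pi_pos]
      exact two_le_pi
    rw [log_abs, abs_mul]
    calc 1 + |-(2 / π)| * |log x| ≤ 1 * (1 + |log x|) := by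
          rw [one_mul]
          gcongr
          exact mul_le_of_le_one_left (abs_nonneg _) hπ
      _ ≤ (1 + |tan (π * α / 2)|) * (1 + |log x|) := by
          gcongr
          exact le_add_of_nonneg_right (abs_nonneg _)
  · rw [mul_one]

lemma norm_stableExponent_le (α x : ℝ) :
    ‖stableExponent α 1 x‖ ≤ (1 + |tan (π * α / 2)|) * growth α x := by
  calc ‖stableExponent α 1 x‖ ≤ |x| ^ α * (1 + |w α x|) := by
        rw [stableExponent, norm_mul, Complex.norm_real, norm_of_nonneg (by positivity), one_mul]
        gcongr
        refine (norm_sub_le _ _).trans ?_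
        rw [norm_one, norm_mul, Complex.norm_I, one_mul, Complex.norm_real, norm_eq_abs, abs_mul]
        gcongr
        exact mul_le_of_le_one_left (abs_nonneg _) (abs_sign_le_one x)
    _ ≤ |x| ^ α * ((1 + |tan (π * α / 2)|) * (if α = 1 then 1 + |log x| else 1)) := by
        gcongr
        exact abs_w_le α x
    _ = (1 + |tan (π * α / 2)|) * growth α x := by rw [growth]; ring

lemma stableExponent_one_eq (β x : ℝ) : stableExponent 1 β x
    = (|x| : ℝ) + ((β * (2 / π * (x * log x)) : ℝ) : ℂ) * Complex.I := by
  have him : |x| * (β * (SignType.sign x : ℝ) * (2 / π * log x)) = β * (2 / π * (x * log x)) := by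
    calc _ = β * (2 / π * (|x| * SignType.sign x * log x)) := by ring
      _ = β * (2 / π * (x * log x)) := by rw [abs_mul_sign]
  apply Complex.ext
  · simp [stableExponent_re]
  · simp [stableExponent_im, w, him]

lemma sign_mul_abs_rpow (hα₀ : 0 < α) (x : ℝ) :
    (SignType.sign x : ℝ) * |x| ^ α = max x 0 ^ α - max (-x) 0 ^ α := by
  rcases lt_trichotomy x 0 with hx | rfl | hx
  · simp [sign_neg hx, abs_of_neg hx, hx.le, zero_rpow hα₀.ne']
  · simp
  · simp [sign_pos hx, abs_of_pos hx, hx.le, zero_rpow hα₀.ne']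

lemma continuous_stableExponent (hα₀ : 0 < α) : Continuous (stableExponent α 1) := by
  by_cases hα : α = 1
  · subst hα
    have : Continuous fun x => x * log x := continuous_mul_log
    simp_rw [funext (stableExponent_one_eq 1)]
    fun_prop
  · have heq (x : ℝ) : stableExponent α 1 x = ((|x| ^ α : ℝ) : ℂ)
        - Complex.I * (((max x 0 ^ α - max (-x) 0 ^ α) * tan (π * α / 2) : ℝ) : ℂ) := by
      rw [stableExponent, w, if_neg hα, ← sign_mul_abs_rpow hα₀]
      push_cast
      ring
    have hpow {f : ℝ → ℝ} (hf : Continuous f) : Continuous fun x => f x ^ α :=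
      hf.rpow_const fun _ => Or.inr hα₀.le
    have := hpow continuous_abs
    have := hpow (f := fun x => max x 0) (by fun_prop)
    have := hpow (f := fun x => max (-x) 0) (by fun_prop)
    simp_rw [funext heq]
    fun_prop

end StableExponent

section SpecExponent

lemma growth_inner_le {E : Type*} [NormedAddCommGroup E] [InnerProductSpace ℝ E] {α : ℝ}
    (hα₀ : 0 < α) (u s : E) :
    growth α ⟪u, s⟫_ℝ ≤ growth α ‖u‖ * growth α ‖s‖ := by
  refine (growth_le_growth hα₀ ?_).trans (growth_mul_le α ‖u‖ ‖s‖)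
  rw [abs_mul, abs_norm, abs_norm]
  exact abs_real_inner_le_norm u s

variable {E : Type*} [NormedAddCommGroup E] [MeasurableSpace E] {α : ℝ} {Γ : Measure E}

/-- The measures with an absolutely convergent exponent: `growth α ‖s‖` is integrable. -/
def IsAdmissible (α : ℝ) (Γ : Measure E) : Prop := Integrable (fun s => growth α ‖s‖) Γ

lemma IsAdmissible.integrable_norm_rpow [BorelSpace E] (h : IsAdmissible α Γ) :
    Integrable (fun s => ‖s‖ ^ α) Γ := by
  refine h.mono' (Measurable.aestronglyMeasurable (by fun_prop)) (ae_of_all _ fun s => ?_)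
  rw [norm_of_nonneg (by positivity)]
  simpa using abs_rpow_le_growth α ‖s‖

variable [InnerProductSpace ℝ E]

/-- The logarithm, up to sign, of the characteristic function of the `α`-stable law with spectral
measure `Γ` and no shift. -/
def specExponent (α : ℝ) (Γ : Measure E) (u : E) : ℂ := ∫ s, stableExponent α 1 ⟪u, s⟫_ℝ ∂Γ

lemma specExponent_zero (hα₀ : 0 < α) (Γ : Measure E) : specExponent α Γ 0 = 0 := by
  simp [specExponent, stableExponent_zero hα₀]

lemma specExponent_neg (α : ℝ) (Γ : Measure E) (u : E) :
    specExponent α Γ (-u) = (starRingEnd ℂ) (specExponent α Γ u) := by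
  simp only [specExponent, inner_neg_left, stableExponent_neg]
  exact integral_conj

variable [BorelSpace E]

lemma integrable_abs_inner_rpow (hα₀ : 0 < α) (hΓ : Integrable (fun s => ‖s‖ ^ α) Γ) (u : E) :
    Integrable (fun s => |⟪u, s⟫_ℝ| ^ α) Γ := by
  have hmeas : Measurable fun s => ⟪u, s⟫_ℝ := Continuous.measurable (by fun_prop)
  refine (hΓ.const_mul (‖u‖ ^ α)).mono'
    (Measurable.aestronglyMeasurable (by fun_prop)) (ae_of_all _ fun s => ?_)
  rw [norm_of_nonneg (by positivity), ← mul_rpow (norm_nonneg _) (norm_nonneg _)]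
  exact rpow_le_rpow (abs_nonneg _) (abs_real_inner_le_norm u s) hα₀.le

lemma aestronglyMeasurable_stableExponent (hα₀ : 0 < α) (Γ : Measure E) (u : E) :
    AEStronglyMeasurable (fun s => stableExponent α 1 ⟪u, s⟫_ℝ) Γ := by
  have hcont := continuous_stableExponent hα₀
  exact Continuous.aestronglyMeasurable (by fun_prop)

namespace IsAdmissible

lemma integrable_growth_inner (hα₀ : 0 < α) (h : IsAdmissible α Γ) (u : E) :
    Integrable (fun s => growth α ⟪u, s⟫_ℝ) Γ := by
  have hmeas : Measurable fun s => ⟪u, s⟫_ℝ := Continuous.measurable (by fun_prop)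
  refine (Integrable.const_mul h (growth α ‖u‖)).mono'
    ((measurable_growth α).comp hmeas).aestronglyMeasurable (ae_of_all _ fun s => ?_)
  rw [norm_of_nonneg (growth_nonneg _ _)]
  exact growth_inner_le hα₀ u s

lemma integrable_stableExponent (hα₀ : 0 < α) (h : IsAdmissible α Γ) (u : E) :
    Integrable (fun s => stableExponent α 1 ⟪u, s⟫_ℝ) Γ :=
  ((h.integrable_growth_inner hα₀ u).const_mul _).mono'
    (aestronglyMeasurable_stableExponent hα₀ Γ u) (ae_of_all _ fun _ => norm_stableExponent_le α _)

lemma specExponent_re (hα₀ : 0 < α) (h : IsAdmissible α Γ) (u : E) :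
    (specExponent α Γ u).re = ∫ s, |⟪u, s⟫_ℝ| ^ α ∂Γ := by
  simp_rw [← stableExponent_re α 1]
  exact (integral_re (h.integrable_stableExponent hα₀ u)).symm

lemma specExponent_im (hα₀ : 0 < α) (h : IsAdmissible α Γ) (u : E) :
    (specExponent α Γ u).im = ∫ s, (stableExponent α 1 ⟪u, s⟫_ℝ).im ∂Γ :=
  (integral_im (h.integrable_stableExponent hα₀ u)).symm

lemma continuous_specExponent (hα₀ : 0 < α) (h : IsAdmissible α Γ) :
    Continuous (specExponent α Γ) := by
  refine continuous_iff_continuousAt.2 fun u₀ => continuousAt_of_dominated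
    (bound := fun s => (1 + |tan (π * α / 2)|) * (growth α (‖u₀‖ + 1) * growth α ‖s‖))
    (Eventually.of_forall fun u => aestronglyMeasurable_stableExponent hα₀ Γ u) ?_
    ((Integrable.const_mul h _).const_mul _) (ae_of_all _ fun s => ?_)
  · filter_upwards [continuous_norm.continuousAt.eventually_lt_const (lt_add_one ‖u₀‖)] with u hu
    refine ae_of_all _ fun s => (norm_stableExponent_le α _).trans ?_
    gcongr
    refine (growth_inner_le hα₀ u s).trans ?_
    gcongr ?_ * _
    · exact growth_nonneg _ _
    · refine growth_le_growth hα₀ ?_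
      rw [abs_norm, abs_of_nonneg (by positivity)]
      exact hu.le
  · have hcont := continuous_stableExponent hα₀
    exact Continuous.continuousAt (by fun_prop)

end IsAdmissible

end SpecExponent

section Uniqueness

lemma exists_denseSeq_cos_inner_lt_one {E : Type*} [NormedAddCommGroup E]
    [InnerProductSpace ℝ E] [TopologicalSpace.SeparableSpace E] {x : E} (hx : x ≠ 0) :
    ∃ n, cos ⟪TopologicalSpace.denseSeq E n, x⟫_ℝ < 1 := by
  have hopen : IsOpen {v : E | cos ⟪v, x⟫_ℝ < 1} := isOpen_lt (by fun_prop) continuous_const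
  obtain ⟨_, hv, n, rfl⟩ := (TopologicalSpace.denseRange_denseSeq E).inter_open_nonempty _ hopen
    ⟨(‖x‖ ^ 2)⁻¹ • x, by
      have : cos 1 < 1 := cos_one_le.trans_lt (by norm_num)
      simpa [real_inner_smul_left, hx] using this⟩
  exact ⟨n, hv⟩

lemma restrict_eq_of_withDensity_eq {α : Type*} [MeasurableSpace α] {μ ν : Measure α}
    {f : α → ℝ≥0∞} (hf : Measurable f) (hf_top : ∀ x, f x ≠ ∞) {U : Set α} (hU : MeasurableSet U)
    (hf₀ : ∀ x ∈ U, f x ≠ 0) (h : μ.withDensity f = ν.withDensity f) :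
    μ.restrict U = ν.restrict U := by
  have hinv (ρ : Measure α) : ((ρ.withDensity f).restrict U).withDensity f⁻¹ = ρ.restrict U := by
    rw [restrict_withDensity hU]
    exact withDensity_inv_same hf (ae_restrict_of_forall_mem hU hf₀) (ae_of_all _ hf_top)
  rw [← hinv μ, h, hinv ν]

variable {E : Type*} [NormedAddCommGroup E] [InnerProductSpace ℝ E] [MeasurableSpace E]
  [BorelSpace E] {M M₁ M₂ : Measure E}

lemma charFun_withDensity_one_sub_cos {v : E} (hM : Integrable (fun x => 1 - cos ⟪v, x⟫_ℝ) M)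
    (u : E) : charFun (M.withDensity fun x => ENNReal.ofReal (1 - cos ⟪v, x⟫_ℝ)) u
      = (∫ x, cos ⟪u, x⟫_ℝ * (1 - cos ⟪v, x⟫_ℝ) ∂M : ℝ)
        + (∫ x, sin ⟪u, x⟫_ℝ * (1 - cos ⟪v, x⟫_ℝ) ∂M : ℝ) * Complex.I := by
  have hcos : Integrable (fun x => cos ⟪u, x⟫_ℝ * (1 - cos ⟪v, x⟫_ℝ)) M :=
    hM.bdd_mul (c := 1) (Continuous.aestronglyMeasurable (by fun_prop))
      (ae_of_all _ fun x => abs_cos_le_one _)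
  have hsin : Integrable (fun x => sin ⟪u, x⟫_ℝ * (1 - cos ⟪v, x⟫_ℝ)) M :=
    hM.bdd_mul (c := 1) (Continuous.aestronglyMeasurable (by fun_prop))
      (ae_of_all _ fun x => abs_sin_le_one _)
  rw [charFun_apply, integral_withDensity_eq_integral_toReal_smul
    (Measurable.ennreal_ofReal (Continuous.measurable (by fun_prop))) (by simp),
    ← integral_complex_ofReal, ← integral_complex_ofReal, ← integral_mul_const,
    ← integral_add hcos.ofReal (hsin.ofReal.mul_const _)]
  refine integral_congr_ae (ae_of_all _ fun x => ?_)
  simp only [ENNReal.toReal_ofReal (one_sub_cos_nonneg _), Complex.exp_mul_I, Complex.real_smul,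
    real_inner_comm u x]
  push_cast
  ring

variable [SecondCountableTopology E] [CompleteSpace E]

lemma withDensity_one_sub_cos_eq {v : E} (h₁ : Integrable (fun x => 1 - cos ⟪v, x⟫_ℝ) M₁)
    (h₂ : Integrable (fun x => 1 - cos ⟪v, x⟫_ℝ) M₂)
    (hcos : ∀ u, ∫ x, cos ⟪u, x⟫_ℝ * (1 - cos ⟪v, x⟫_ℝ) ∂M₁
      = ∫ x, cos ⟪u, x⟫_ℝ * (1 - cos ⟪v, x⟫_ℝ) ∂M₂)
    (hsin : ∀ u, ∫ x, sin ⟪u, x⟫_ℝ * (1 - cos ⟪v, x⟫_ℝ) ∂M₁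
      = ∫ x, sin ⟪u, x⟫_ℝ * (1 - cos ⟪v, x⟫_ℝ) ∂M₂) :
    M₁.withDensity (fun x => ENNReal.ofReal (1 - cos ⟪v, x⟫_ℝ))
      = M₂.withDensity fun x => ENNReal.ofReal (1 - cos ⟪v, x⟫_ℝ) := by
  have := isFiniteMeasure_withDensity_ofReal h₁.2
  have := isFiniteMeasure_withDensity_ofReal h₂.2
  refine Measure.ext_of_charFun (funext fun u => ?_)
  rw [charFun_withDensity_one_sub_cos h₁, charFun_withDensity_one_sub_cos h₂, hcos, hsin]

lemma restrict_compl_zero_eq (h₁ : ∀ v, Integrable (fun x => 1 - cos ⟪v, x⟫_ℝ) M₁)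
    (h₂ : ∀ v, Integrable (fun x => 1 - cos ⟪v, x⟫_ℝ) M₂)
    (hcos : ∀ u v, ∫ x, cos ⟪u, x⟫_ℝ * (1 - cos ⟪v, x⟫_ℝ) ∂M₁
      = ∫ x, cos ⟪u, x⟫_ℝ * (1 - cos ⟪v, x⟫_ℝ) ∂M₂)
    (hsin : ∀ u v, ∫ x, sin ⟪u, x⟫_ℝ * (1 - cos ⟪v, x⟫_ℝ) ∂M₁
      = ∫ x, sin ⟪u, x⟫_ℝ * (1 - cos ⟪v, x⟫_ℝ) ∂M₂) :
    M₁.restrict {0}ᶜ = M₂.restrict {0}ᶜ := by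
  have hcover : {0}ᶜ ⊆ ⋃ n, {x : E | cos ⟪TopologicalSpace.denseSeq E n, x⟫_ℝ < 1} := fun x hx =>
    mem_iUnion.2 (exists_denseSeq_cos_inner_lt_one hx)
  refine Measure.restrict_congr_mono hcover (Measure.restrict_iUnion_congr.2 fun n => ?_)
  have hcont : Continuous fun x => cos ⟪TopologicalSpace.denseSeq E n, x⟫_ℝ := by fun_prop
  refine restrict_eq_of_withDensity_eq (hcont.measurable.const_sub 1).ennreal_ofReal (by simp)
    (measurableSet_lt hcont.measurable measurable_const) (fun x hx => ?_)
    (withDensity_one_sub_cos_eq (h₁ _) (h₂ _) (fun u => hcos u _) fun u => hsin u _)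
  exact (ENNReal.ofReal_pos.2 (sub_pos.2 hx)).ne'

end Uniqueness

section LevyMeasure

lemma integral_eq_zero_of_odd {E : Type*} [NormedAddCommGroup E] [MeasurableSpace E] [BorelSpace E]
    {Γ : Measure E} {f : E → ℝ} (hf : ∀ x, f (-x) = -f x) (hΓ : Γ.map (fun s => -s) = Γ) :
    ∫ x, f x ∂Γ = 0 := by
  refine self_eq_neg.1 ?_
  calc ∫ x, f x ∂Γ = ∫ x, f x ∂(Γ.map (MeasurableEquiv.neg E)) := by
        rw [show Γ.map (MeasurableEquiv.neg E) = Γ from hΓ]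
    _ = ∫ x, -f x ∂Γ := by rw [integral_map_equiv]; exact integral_congr_ae (ae_of_all _ hf)
    _ = -∫ x, f x ∂Γ := integral_neg f

variable {E : Type*} [NormedAddCommGroup E] [InnerProductSpace ℝ E] [MeasurableSpace E]
  {α : ℝ} {Γ Γ₁ Γ₂ : Measure E}

/-- The Lévy measure of the stable law with spectral measure `Γ`: the image of `Γ ⊗ r^(-1-α) dr`
under `(s, r) ↦ r • s`. The measure `Γ` may live anywhere, not only on a sphere. -/
def levyMeasure (α : ℝ) (Γ : Measure E) : Measure E :=
  (Γ.prod (rayMeasure α)).map fun q => q.2 • q.1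

lemma integral_secondDiff {φ : ℝ → ℝ} (hφ : ∀ u, Integrable (fun s => φ ⟪u, s⟫_ℝ) Γ) (u v : E) :
    ∫ s, secondDiff φ ⟪u, s⟫_ℝ ⟪v, s⟫_ℝ ∂Γ = secondDiff (fun u => ∫ s, φ ⟪u, s⟫_ℝ ∂Γ) u v := by
  simp only [secondDiff, ← inner_add_left, ← inner_sub_left]
  have hadd : Integrable (fun s => φ ⟪u + v, s⟫_ℝ + φ ⟪u - v, s⟫_ℝ) Γ := (hφ _).add (hφ _)
  simp only [nsmul_eq_mul]
  rw [integral_sub hadd ((hφ u).const_mul _), integral_add (hφ _) (hφ _), integral_const_mul]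

variable [BorelSpace E]

lemma measurable_snd_smul_fst : Measurable fun q : E × ℝ => q.2 • q.1 :=
  (continuous_snd.smul continuous_fst).measurable

lemma integral_levyMeasure [SFinite Γ] {f : E → ℝ} (hf : Integrable f (levyMeasure α Γ)) :
    ∫ x, f x ∂(levyMeasure α Γ) = ∫ s, ∫ r, f (r • s) ∂(rayMeasure α) ∂Γ := by
  rw [levyMeasure, integral_map measurable_snd_smul_fst.aemeasurable hf.1]
  exact integral_prod _ (hf.comp_measurable measurable_snd_smul_fst)

lemma integrable_one_sub_cos_levyMeasure (hα₀ : 0 < α) (hα₂ : α < 2)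
    (hΓ : Integrable (fun s => ‖s‖ ^ α) Γ) (v : E) :
    Integrable (fun x => 1 - cos ⟪v, x⟫_ℝ) (levyMeasure α Γ) := by
  have hcont : Continuous fun x => 1 - cos ⟪v, x⟫_ℝ := by fun_prop
  rw [levyMeasure, integrable_map_measure hcont.aestronglyMeasurable
    measurable_snd_smul_fst.aemeasurable, integrable_prod_iff
      (hcont.measurable.comp measurable_snd_smul_fst).aestronglyMeasurable]
  simp only [Function.comp_apply, real_inner_smul_right, mul_comm _ ⟪v, _⟫_ℝ,
    norm_of_nonneg (one_sub_cos_nonneg _), integral_one_sub_cos hα₀]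
  exact ⟨ae_of_all _ fun s => integrable_one_sub_cos hα₀ hα₂ _,
    (integrable_abs_inner_rpow hα₀ hΓ v).mul_const _⟩

lemma integrable_mul_one_sub_cos_levyMeasure (hα₀ : 0 < α) (hα₂ : α < 2)
    (hΓ : Integrable (fun s => ‖s‖ ^ α) Γ) {f : E → ℝ} (hf : Continuous f)
    (hf₁ : ∀ x, |f x| ≤ 1) (v : E) :
    Integrable (fun x => f x * (1 - cos ⟪v, x⟫_ℝ)) (levyMeasure α Γ) :=
  (integrable_one_sub_cos_levyMeasure hα₀ hα₂ hΓ v).bdd_mul hf.aestronglyMeasurable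
    (ae_of_all _ hf₁)

lemma integral_cos_mul_one_sub_cos_levyMeasure (hα₀ : 0 < α) (hα₂ : α < 2) [SFinite Γ]
    (hΓ : Integrable (fun s => ‖s‖ ^ α) Γ) (u v : E) :
    ∫ x, cos ⟪u, x⟫_ℝ * (1 - cos ⟪v, x⟫_ℝ) ∂(levyMeasure α Γ)
      = (∫ r, (1 - cos r) ∂(rayMeasure α)) / 2
        * secondDiff (fun u => ∫ s, |⟪u, s⟫_ℝ| ^ α ∂Γ) u v := by
  rw [integral_levyMeasure (integrable_mul_one_sub_cos_levyMeasure hα₀ hα₂ hΓ (by fun_prop)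
    (fun x => abs_cos_le_one _) v),
    ← integral_secondDiff (φ := fun t => |t| ^ α) (integrable_abs_inner_rpow hα₀ hΓ),
    ← integral_const_mul]
  congr with s
  simp only [real_inner_smul_right, mul_comm _ ⟪_, s⟫_ℝ, ← integral_cos_mul_one_sub_cos hα₀ hα₂]

lemma exists_integral_sin_mul_one_sub_cos_levyMeasure (hα₀ : 0 < α) (hα₂ : α < 2) :
    ∃ c : ℝ, ∀ (Γ : Measure E) [SFinite Γ], IsAdmissible α Γ → ∀ u v,
      ∫ x, sin ⟪u, x⟫_ℝ * (1 - cos ⟪v, x⟫_ℝ) ∂(levyMeasure α Γ)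
        = c * secondDiff (fun u => (specExponent α Γ u).im) u v := by
  obtain ⟨c, hc⟩ := exists_integral_sin_mul_one_sub_cos hα₀ hα₂
  refine ⟨c, fun Γ _ hΓ u v => ?_⟩
  rw [integral_levyMeasure (integrable_mul_one_sub_cos_levyMeasure hα₀ hα₂ hΓ.integrable_norm_rpow
    (by fun_prop) (fun x => abs_sin_le_one _) v), funext (hΓ.specExponent_im hα₀),
    ← integral_secondDiff (φ := fun t => (stableExponent α 1 t).im)
      (fun u => (hΓ.integrable_stableExponent hα₀ u).im), ← integral_const_mul]
  congr with s
  simp only [real_inner_smul_right, mul_comm _ ⟪_, s⟫_ℝ, ← hc]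

lemma integral_sin_mul_one_sub_cos_levyMeasure_of_symm (hα₀ : 0 < α) (hα₂ : α < 2) [SFinite Γ]
    (hΓ : Integrable (fun s => ‖s‖ ^ α) Γ) (hsymm : Γ.map (fun s => -s) = Γ) (u v : E) :
    ∫ x, sin ⟪u, x⟫_ℝ * (1 - cos ⟪v, x⟫_ℝ) ∂(levyMeasure α Γ) = 0 := by
  rw [integral_levyMeasure (integrable_mul_one_sub_cos_levyMeasure hα₀ hα₂ hΓ (by fun_prop)
    (fun x => abs_sin_le_one _) v)]
  refine integral_eq_zero_of_odd (fun s => ?_) hsymm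
  simp only [smul_neg, inner_neg_right, sin_neg, cos_neg, neg_mul, integral_neg]

lemma restrict_levyMeasure_eq [SecondCountableTopology E] [CompleteSpace E] (hα₀ : 0 < α)
    (hα₂ : α < 2) [SFinite Γ₁] [SFinite Γ₂] (h₁ : Integrable (fun s => ‖s‖ ^ α) Γ₁)
    (h₂ : Integrable (fun s => ‖s‖ ^ α) Γ₂)
    (habs : ∀ u, ∫ s, |⟪u, s⟫_ℝ| ^ α ∂Γ₁ = ∫ s, |⟪u, s⟫_ℝ| ^ α ∂Γ₂)
    (hsin : ∀ u v, ∫ x, sin ⟪u, x⟫_ℝ * (1 - cos ⟪v, x⟫_ℝ) ∂(levyMeasure α Γ₁)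
      = ∫ x, sin ⟪u, x⟫_ℝ * (1 - cos ⟪v, x⟫_ℝ) ∂(levyMeasure α Γ₂)) :
    (levyMeasure α Γ₁).restrict {0}ᶜ = (levyMeasure α Γ₂).restrict {0}ᶜ := by
  refine restrict_compl_zero_eq (integrable_one_sub_cos_levyMeasure hα₀ hα₂ h₁)
    (integrable_one_sub_cos_levyMeasure hα₀ hα₂ h₂) (fun u v => ?_) hsin
  rw [integral_cos_mul_one_sub_cos_levyMeasure hα₀ hα₂ h₁,
    integral_cos_mul_one_sub_cos_levyMeasure hα₀ hα₂ h₂, funext habs]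

lemma ae_levyMeasure_iff (hα₀ : 0 < α) {p : E → Prop} (hp : MeasurableSet {x | p x})
    (hsmul : ∀ r : ℝ, 0 < r → ∀ s, p (r • s) ↔ p s) :
    (∀ᵐ x ∂(levyMeasure α Γ), p x) ↔ ∀ᵐ s ∂Γ, p s := by
  have : (ae (rayMeasure α)).NeBot := by
    refine ae_neBot.2 fun h => ?_
    simpa [h, hα₀.not_ge] using rayMeasure_Ioi hα₀ one_pos
  rw [levyMeasure, ae_map_iff measurable_snd_smul_fst.aemeasurable hp,
    Measure.ae_prod_iff_ae_ae (p := fun q : E × ℝ => p (q.2 • q.1)) (measurable_snd_smul_fst hp)]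
  refine eventually_congr (Eventually.of_forall fun s => ?_)
  rw [eventually_congr (ae_rayMeasure_pos.mono fun r hr => hsmul r hr s), eventually_const]

end LevyMeasure

section ContinuousLog

lemma eq_of_exp_eq {X : Type*} [TopologicalSpace X] [PreconnectedSpace X] {F G : X → ℂ}
    (hF : Continuous F) (hG : Continuous G) {x₀ : X} (h₀ : F x₀ = G x₀)
    (h : ∀ x, Complex.exp (F x) = Complex.exp (G x)) : F = G :=
  Complex.isCoveringMap_exp.eq_of_comp_eq hF hG (funext fun x => Subtype.ext (h x)) x₀ h₀

end ContinuousLog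

section RadialProj

variable {E : Type*} [NormedAddCommGroup E] [NormedSpace ℝ E] {N : Seminorm ℝ E}

/-- The projection of `{s | N s ≠ 0}` on `{s | N s = 1}` along rays; it sends `{s | N s = 0}`
to `0`. -/
def radialProj (N : Seminorm ℝ E) (s : E) : E := (N s)⁻¹ • s

lemma seminorm_smul_of_pos (N : Seminorm ℝ E) {r : ℝ} (hr : 0 < r) (s : E) :
    N (r • s) = r * N s := by
  rw [map_smul_eq_mul, norm_of_nonneg hr.le]

lemma radialProj_smul {r : ℝ} (hr : 0 < r) (s : E) : radialProj N (r • s) = radialProj N s := by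
  rw [radialProj, radialProj, seminorm_smul_of_pos N hr, mul_inv_rev, smul_smul, mul_assoc,
    inv_mul_cancel₀ hr.ne', mul_one]

lemma radialProj_neg (s : E) : radialProj N (-s) = -radialProj N s := by
  rw [radialProj, radialProj, map_neg_eq_map, smul_neg]

lemma radialProj_of_eq_one {s : E} (hs : N s = 1) : radialProj N s = s := by
  rw [radialProj, hs, inv_one, one_smul]

lemma seminorm_radialProj {s : E} (hs : N s ≠ 0) : N (radialProj N s) = 1 := by
  rw [radialProj, map_smul_eq_mul, norm_inv, norm_of_nonneg (apply_nonneg N s), inv_mul_cancel₀ hs]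

lemma measurable_radialProj [MeasurableSpace E] [BorelSpace E] (hN : Continuous N) :
    Measurable (radialProj N) := by
  have : Measurable N := hN.measurable
  unfold radialProj
  fun_prop

end RadialProj

section CylProj

variable {E : Type*} [NormedAddCommGroup E] [NormedSpace ℝ E] [MeasurableSpace E] {α : ℝ}
  {N : Seminorm ℝ E} {Γ : Measure E}

/-- The measure on `{s | N s = 1}` which induces the same `α`-stable Lévy measure as `Γ`, provided
`Γ` does not charge `{s | N s = 0}`: the image of `N s ^ α Γ(ds)` under `radialProj N`. -/
def cylProj (α : ℝ) (N : Seminorm ℝ E) (Γ : Measure E) : Measure E :=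
  (Γ.withDensity fun s => ENNReal.ofReal (N s ^ α)).map (radialProj N)

lemma cylProj_eq_self (hΓ : ∀ᵐ s ∂Γ, N s = 1) : cylProj α N Γ = Γ := by
  have hdensity : (Γ.withDensity fun s => ENNReal.ofReal (N s ^ α)) = Γ := by
    conv_rhs => rw [← withDensity_one (μ := Γ)]
    refine withDensity_congr_ae (hΓ.mono fun s hs => ?_)
    simp [hs]
  rw [cylProj, hdensity]
  conv_rhs => rw [← Measure.map_id (μ := Γ)]
  exact Measure.map_congr (hΓ.mono fun s hs => radialProj_of_eq_one hs)

variable [BorelSpace E]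

lemma lintegral_cylProj (hN : Continuous N) {f : E → ℝ≥0∞} (hf : Measurable f) :
    ∫⁻ s, f s ∂(cylProj α N Γ) = ∫⁻ s, ENNReal.ofReal (N s ^ α) * f (radialProj N s) ∂Γ := by
  have : Measurable N := hN.measurable
  rw [cylProj, lintegral_map hf (measurable_radialProj hN)]
  exact lintegral_withDensity_eq_lintegral_mul _ (by fun_prop)
    (hf.comp (measurable_radialProj hN))

lemma ae_cylProj_eq_one (hα₀ : 0 < α) (hN : Continuous N) (Γ : Measure E) :
    ∀ᵐ s ∂(cylProj α N Γ), N s = 1 := by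
  have : Measurable N := hN.measurable
  rw [cylProj, ae_map_iff (measurable_radialProj hN).aemeasurable
    (measurableSet_eq_fun hN.measurable measurable_const), ae_withDensity_iff (by fun_prop)]
  refine ae_of_all _ fun s hs => seminorm_radialProj fun h₀ => hs ?_
  rw [h₀, zero_rpow hα₀.ne', ENNReal.ofReal_zero]

variable {F : Type*} [NormedAddCommGroup F] [NormedSpace ℝ F] {f : E → F}

lemma integrable_cylProj_iff (hN : Continuous N) (hf : StronglyMeasurable f) :
    Integrable f (cylProj α N Γ) ↔ Integrable (fun s => N s ^ α • f (radialProj N s)) Γ := by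
  have : Measurable N := hN.measurable
  rw [cylProj, integrable_map_measure hf.aestronglyMeasurable
    (measurable_radialProj hN).aemeasurable,
    integrable_withDensity_iff_integrable_smul' (by fun_prop) (by simp)]
  simp only [ENNReal.toReal_ofReal (rpow_nonneg (apply_nonneg N _) _), Function.comp_apply]

lemma integral_cylProj (hN : Continuous N) (hf : StronglyMeasurable f) :
    ∫ s, f s ∂(cylProj α N Γ) = ∫ s, N s ^ α • f (radialProj N s) ∂Γ := by
  have : Measurable N := hN.measurable
  rw [cylProj, integral_map (measurable_radialProj hN).aemeasurable hf.aestronglyMeasurable,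
    integral_withDensity_eq_integral_toReal_smul (by fun_prop) (by simp)]
  simp only [ENNReal.toReal_ofReal (rpow_nonneg (apply_nonneg N _) _)]

lemma cylProj_map_neg (hN : Continuous N) (Γ : Measure E) :
    cylProj α N (Γ.map fun s => -s) = (cylProj α N Γ).map fun s => -s := by
  have : Measurable N := hN.measurable
  refine Measure.ext_of_lintegral _ fun f hf => ?_
  have hcomp : Measurable fun s => ENNReal.ofReal (N s ^ α) * f (radialProj N s) :=
    (by fun_prop : Measurable fun s => ENNReal.ofReal (N s ^ α)).mul
      (hf.comp (measurable_radialProj hN))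
  rw [lintegral_map hf measurable_neg, lintegral_cylProj hN hf,
    lintegral_cylProj hN (f := fun s => f (-s)) (hf.comp measurable_neg),
    lintegral_map hcomp measurable_neg]
  simp only [map_neg_eq_map, radialProj_neg]

end CylProj

section Determination

variable {E : Type*} [NormedAddCommGroup E] [InnerProductSpace ℝ E] [MeasurableSpace E]
  [BorelSpace E] {α : ℝ} {N : Seminorm ℝ E} {Γ Γ₁ Γ₂ : Measure E}

lemma rayMeasure_one_lt_mul (hα₀ : 0 < α) {a : ℝ} (ha : 0 ≤ a) :
    rayMeasure α {r | 1 < r * a} = ENNReal.ofReal (a ^ α) * ENNReal.ofReal (1 / α) := by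
  rcases ha.eq_or_lt with rfl | ha
  · simp [zero_rpow hα₀.ne', zero_lt_one.not_gt]
  · have hset : {r | 1 < r * a} = Ioi a⁻¹ := by
      ext r
      exact (inv_lt_iff_one_lt_mul₀ ha).symm
    rw [hset, rayMeasure_Ioi hα₀ (inv_pos.2 ha), ← ENNReal.ofReal_mul (by positivity),
      inv_rpow ha.le, rpow_neg ha.le, inv_inv, mul_one_div]

lemma levyMeasure_tail (hα₀ : 0 < α) (hN : Continuous N) {A : Set E} (hA : MeasurableSet A) :
    levyMeasure α Γ {x | 1 < N x ∧ radialProj N x ∈ A}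
      = cylProj α N Γ A * ENNReal.ofReal (1 / α) := by
  have hNm : Measurable N := hN.measurable
  have hproj := measurable_radialProj hN
  have hdensity : Measurable fun s => ENNReal.ofReal (N s ^ α) * A.indicator 1 (radialProj N s) :=
    (by fun_prop : Measurable fun s => ENNReal.ofReal (N s ^ α)).mul
      ((measurable_one.indicator hA).comp hproj)
  have hS : MeasurableSet {x | 1 < N x ∧ radialProj N x ∈ A} :=
    (measurableSet_lt measurable_const hNm).inter (hproj hA)
  rw [levyMeasure, Measure.map_apply measurable_snd_smul_fst hS,
    Measure.prod_apply (measurable_snd_smul_fst hS), ← lintegral_indicator_one hA,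
    lintegral_cylProj hN (measurable_one.indicator hA),
    ← lintegral_mul_const _ hdensity]
  refine lintegral_congr fun s => ?_
  have hfibre : Prod.mk s ⁻¹' ((fun q : E × ℝ => q.2 • q.1) ⁻¹'
      {x | 1 < N x ∧ radialProj N x ∈ A}) =ᵐ[rayMeasure α]
        {r | 1 < r * N s ∧ radialProj N s ∈ A} := by
    filter_upwards [ae_rayMeasure_pos] with r hr
    change (1 < N (r • s) ∧ radialProj N (r • s) ∈ A) = _
    rw [seminorm_smul_of_pos N hr, radialProj_smul hr]
    rfl
  rw [measure_congr hfibre]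
  by_cases hs : radialProj N s ∈ A
  · simpa [hs] using rayMeasure_one_lt_mul hα₀ (apply_nonneg N s)
  · simp [hs]

lemma cylProj_eq_of_restrict_levyMeasure_eq (hα₀ : 0 < α) (hN : Continuous N)
    (h : (levyMeasure α Γ₁).restrict {0}ᶜ = (levyMeasure α Γ₂).restrict {0}ᶜ) :
    cylProj α N Γ₁ = cylProj α N Γ₂ := by
  ext A hA
  have htail : {x | 1 < N x ∧ radialProj N x ∈ A} ⊆ {0}ᶜ := by
    rintro x ⟨hx, -⟩ rfl
    exact hx.not_ge (by simp)
  refine (ENNReal.mul_left_inj (c := ENNReal.ofReal (1 / α)) (by simpa using hα₀)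
    ENNReal.ofReal_ne_top).1 ?_
  rw [← levyMeasure_tail hα₀ hN hA, ← levyMeasure_tail hα₀ hN hA,
    ← Measure.restrict_eq_self _ htail, h, Measure.restrict_eq_self _ htail]

lemma ae_eq_zero_of_seminorm_eq_zero_of_restrict_levyMeasure_eq (hα₀ : 0 < α) (hN : Continuous N)
    (h : (levyMeasure α Γ₁).restrict {0}ᶜ = (levyMeasure α Γ₂).restrict {0}ᶜ)
    (h₁ : ∀ᵐ s ∂Γ₁, N s = 0 → s = 0) : ∀ᵐ s ∂Γ₂, N s = 0 → s = 0 := by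
  have hmeas : MeasurableSet {x : E | N x = 0 → x = 0} :=
    (measurableSet_eq_fun hN.measurable measurable_const).imp (measurableSet_singleton 0)
  have hsmul (r : ℝ) (hr : 0 < r) (s : E) : (N (r • s) = 0 → r • s = 0) ↔ (N s = 0 → s = 0) := by
    rw [seminorm_smul_of_pos N hr, mul_eq_zero_iff_left hr.ne', smul_eq_zero_iff_right hr.ne']
  rw [← ae_levyMeasure_iff hα₀ hmeas hsmul] at h₁ ⊢
  have hrestrict := h ▸ ae_restrict_of_ae (s := {0}ᶜ) h₁
  filter_upwards [(ae_restrict_iff hmeas).1 hrestrict] with x hx hNx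
  by_contra hx₀
  exact hx₀ (hx hx₀ hNx)

end Determination

section Homogeneity

variable {α r : ℝ}

lemma stableExponent_mul (hα₀ : 0 < α) (hα : α ≠ 1) (β : ℝ) (hr : 0 ≤ r) (x : ℝ) :
    stableExponent α β (r * x) = r ^ α • stableExponent α β x := by
  rcases hr.eq_or_lt with rfl | hr
  · rw [zero_mul, stableExponent_zero hα₀, zero_rpow hα₀.ne', zero_smul]
  · simp only [stableExponent, w, if_neg hα, abs_mul, abs_of_pos hr, mul_rpow hr.le (abs_nonneg x),
      sign_mul, sign_pos hr, one_mul, Complex.real_smul]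
    push_cast
    ring

lemma stableExponent_one_mul (β : ℝ) (hr : 0 ≤ r) (x : ℝ) :
    stableExponent 1 β (r * x) = r • stableExponent 1 β x
      + ((β * (2 / π * (log r * (r * x))) : ℝ) : ℂ) * Complex.I := by
  rcases hr.eq_or_lt with rfl | hr
  · simp [stableExponent_zero one_pos]
  rcases eq_or_ne x 0 with rfl | hx
  · simp [stableExponent_zero one_pos]
  · rw [stableExponent_one_eq, stableExponent_one_eq, abs_mul, abs_of_pos hr,
      log_mul hr.ne' hx, Complex.real_smul]
    push_cast
    ring

variable {E : Type*} [NormedAddCommGroup E] [NormedSpace ℝ E] {N : Seminorm ℝ E} {s : E}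

lemma seminorm_smul_radialProj (hs : N s = 0 → s = 0) : N s • radialProj N s = s := by
  by_cases h₀ : N s = 0
  · rw [hs h₀, map_zero, zero_smul]
  · rw [radialProj, smul_smul, mul_inv_cancel₀ h₀, one_smul]

end Homogeneity

section Projection

lemma IsAdmissible.map_neg {E : Type*} [NormedAddCommGroup E] [MeasurableSpace E]
    [BorelSpace E] {α : ℝ} {Γ : Measure E} (h : IsAdmissible α Γ) :
    IsAdmissible α (Γ.map fun s => -s) := by
  refine (integrable_map_equiv (MeasurableEquiv.neg E) _).2 (h.congr (ae_of_all _ fun s => ?_))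
  rw [Function.comp_apply, MeasurableEquiv.neg_apply, norm_neg]

lemma rpow_smul_abs_inner_radialProj {α : ℝ} {E : Type*}
    [NormedAddCommGroup E] [InnerProductSpace ℝ E] {N : Seminorm ℝ E} (u : E) {s : E}
    (hs : N s = 0 → s = 0) :
    N s ^ α • |⟪u, radialProj N s⟫_ℝ| ^ α = |⟪u, s⟫_ℝ| ^ α := by
  conv_rhs => rw [← seminorm_smul_radialProj hs, inner_smul_right, abs_mul,
    abs_of_nonneg (apply_nonneg N s), mul_rpow (apply_nonneg N s) (abs_nonneg _)]
  rfl

variable {E : Type*} [NormedAddCommGroup E] [InnerProductSpace ℝ E] [MeasurableSpace E]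
  [BorelSpace E] {α : ℝ} {N : Seminorm ℝ E} {Γ : Measure E}

lemma specExponent_map_neg (α : ℝ) (Γ : Measure E) (u : E) :
    specExponent α (Γ.map fun s => -s) u = (starRingEnd ℂ) (specExponent α Γ u) := by
  rw [← specExponent_neg, specExponent, specExponent]
  refine (integral_map_equiv (MeasurableEquiv.neg E) _).trans ?_
  simp only [MeasurableEquiv.neg_apply, inner_neg_right, inner_neg_left]

lemma cylProj_map_neg_eq_self [SecondCountableTopology E] [CompleteSpace E] (hα₀ : 0 < α)
    (hα₂ : α < 2) [SFinite Γ] (hN : Continuous N) (hΓ : IsAdmissible α Γ)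
    (him : ∀ u, (specExponent α Γ u).im = 0) :
    (cylProj α N Γ).map (fun s => -s) = cylProj α N Γ := by
  rw [← cylProj_map_neg hN]
  refine cylProj_eq_of_restrict_levyMeasure_eq hα₀ hN (restrict_levyMeasure_eq hα₀ hα₂
    hΓ.map_neg.integrable_norm_rpow hΓ.integrable_norm_rpow (fun u => ?_) fun u v => ?_)
  · rw [← hΓ.map_neg.specExponent_re hα₀, ← hΓ.specExponent_re hα₀, specExponent_map_neg,
      Complex.conj_re]
  · obtain ⟨c, hc⟩ := exists_integral_sin_mul_one_sub_cos_levyMeasure (E := E) hα₀ hα₂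
    simp only [hc _ hΓ.map_neg, hc _ hΓ, specExponent_map_neg, Complex.conj_im, him, neg_zero]

lemma integrable_abs_inner_cylProj (hα₀ : 0 < α) (hN : Continuous N)
    (hK : ∀ᵐ s ∂Γ, N s = 0 → s = 0) (hΓ : Integrable (fun s => ‖s‖ ^ α) Γ) (u : E) :
    Integrable (fun s => |⟪u, s⟫_ℝ| ^ α) (cylProj α N Γ) := by
  rw [integrable_cylProj_iff hN (Measurable.stronglyMeasurable (by fun_prop))]
  exact (integrable_abs_inner_rpow hα₀ hΓ u).congr
    (hK.mono fun s hs => (rpow_smul_abs_inner_radialProj u hs).symm)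

lemma integral_abs_inner_cylProj (hN : Continuous N)
    (hK : ∀ᵐ s ∂Γ, N s = 0 → s = 0) (u : E) :
    ∫ s, |⟪u, s⟫_ℝ| ^ α ∂(cylProj α N Γ) = ∫ s, |⟪u, s⟫_ℝ| ^ α ∂Γ := by
  rw [integral_cylProj hN (Measurable.stronglyMeasurable (by fun_prop))]
  exact integral_congr_ae (hK.mono fun s hs => rpow_smul_abs_inner_radialProj u hs)

lemma specExponent_cylProj (hα₀ : 0 < α) (hα : α ≠ 1) (hN : Continuous N)
    (hK : ∀ᵐ s ∂Γ, N s = 0 → s = 0) (u : E) :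
    specExponent α (cylProj α N Γ) u = specExponent α Γ u := by
  have := continuous_stableExponent hα₀
  rw [specExponent, integral_cylProj hN (Continuous.stronglyMeasurable (by fun_prop)), specExponent]
  refine integral_congr_ae (hK.mono fun s hs => ?_)
  change N s ^ α • stableExponent α 1 ⟪u, radialProj N s⟫_ℝ = stableExponent α 1 ⟪u, s⟫_ℝ
  conv_rhs => rw [← seminorm_smul_radialProj hs, inner_smul_right,
    stableExponent_mul hα₀ hα 1 (apply_nonneg N s)]

/-- The shift which comes with the projection on `{s | N s = 1}` when `α = 1`. -/
def cylShift (N : Seminorm ℝ E) (Γ : Measure E) : E := (-(2 / π)) • ∫ s, log (N s) • s ∂Γ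

lemma specExponent_one_cylProj [CompleteSpace E] (hN : Continuous N) (hΓ : IsAdmissible 1 Γ)
    (hK : ∀ᵐ s ∂Γ, N s = 0 → s = 0) (hlog : Integrable (fun s => log (N s) • s) Γ) (u : E) :
    specExponent 1 (cylProj 1 N Γ) u
      = specExponent 1 Γ u + Complex.I * ((⟪u, cylShift N Γ⟫_ℝ : ℝ) : ℂ) := by
  have := continuous_stableExponent one_pos
  have hshift : Integrable (fun s => ((2 / π * ⟪u, log (N s) • s⟫_ℝ : ℝ) : ℂ) * Complex.I) Γ :=
    ((hlog.const_inner u).const_mul _).ofReal.mul_const _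
  have hpt : ∀ s, (N s = 0 → s = 0) → N s ^ (1 : ℝ) • stableExponent 1 1 ⟪u, radialProj N s⟫_ℝ
      = stableExponent 1 1 ⟪u, s⟫_ℝ
        - ((2 / π * ⟪u, log (N s) • s⟫_ℝ : ℝ) : ℂ) * Complex.I := by
    intro s hs
    have hinner : ⟪u, s⟫_ℝ = N s * ⟪u, radialProj N s⟫_ℝ := by
      rw [← inner_smul_right, seminorm_smul_radialProj hs]
    rw [inner_smul_right, hinner, stableExponent_one_mul 1 (apply_nonneg N s), rpow_one, one_mul,
      add_sub_cancel_right]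
  rw [specExponent, integral_cylProj hN (Continuous.stronglyMeasurable (by fun_prop)),
    integral_congr_ae (hK.mono hpt), integral_sub (hΓ.integrable_stableExponent one_pos u) hshift,
    integral_mul_const, integral_complex_ofReal, integral_const_mul, integral_inner hlog u,
    cylShift, inner_smul_right, specExponent]
  push_cast
  ring

lemma isAdmissible_one_cylProj_iff (hN : Continuous N) (hΓ : IsAdmissible 1 Γ)
    (hK : ∀ᵐ s ∂Γ, N s = 0 → s = 0) : IsAdmissible 1 (cylProj 1 N Γ) ↔
      Integrable (fun s => ‖s‖ * |log (N s / ‖s‖)|) Γ := by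
  have : Measurable N := hN.measurable
  have hpt (s : E) (hs : N s = 0 → s = 0) : N s ^ (1 : ℝ) • growth 1 ‖radialProj N s‖
      = ‖s‖ + ‖s‖ * |log (N s / ‖s‖)| := by
    have hnorm : N s * ‖radialProj N s‖ = ‖s‖ := by
      conv_rhs => rw [← seminorm_smul_radialProj hs, norm_smul, norm_of_nonneg (apply_nonneg N s)]
    have hlog : |log ‖radialProj N s‖| = |log (N s / ‖s‖)| := by
      rw [radialProj, norm_smul, norm_inv, norm_of_nonneg (apply_nonneg N s), ← abs_neg, ← log_inv,
        mul_inv, inv_inv, div_eq_mul_inv]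
    rw [growth_one, abs_norm, hlog, rpow_one, smul_eq_mul, ← mul_assoc, hnorm, mul_one_add]
  have hnorm : Integrable (fun s => ‖s‖) Γ := by simpa using hΓ.integrable_norm_rpow
  have hmeas : StronglyMeasurable fun s : E => growth 1 ‖s‖ :=
    ((measurable_growth 1).comp measurable_norm).stronglyMeasurable
  rw [IsAdmissible, integrable_cylProj_iff hN hmeas, integrable_congr (hK.mono hpt)]
  exact integrable_add_iff_integrable_right hnorm

lemma integrable_log_smul_of_integrable_log_div [SecondCountableTopology E] (hN : Continuous N)
    (hΓ : IsAdmissible 1 Γ) (hK : ∀ᵐ s ∂Γ, N s = 0 → s = 0)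
    (hlog : Integrable (fun s => ‖s‖ * |log (N s / ‖s‖)|) Γ) :
    Integrable (fun s => log (N s) • s) Γ := by
  have : Measurable N := hN.measurable
  have hgrowth : Integrable (fun s => ‖s‖ * (1 + |log ‖s‖|)) Γ := by
    simpa [IsAdmissible, growth_one] using hΓ
  refine (hlog.add hgrowth).mono' (this.log.aestronglyMeasurable.smul aestronglyMeasurable_id)
    (hK.mono fun s hs => ?_)
  rcases eq_or_ne s 0 with rfl | hs₀
  · simp
  have hsplit : |log (N s)| ≤ |log (N s / ‖s‖)| + |log ‖s‖| := by
    refine le_trans (le_of_eq ?_) (abs_add_le _ _)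
    rw [log_div (mt hs hs₀) (norm_ne_zero_iff.2 hs₀), sub_add_cancel]
  rw [norm_smul, norm_eq_abs, mul_comm, Pi.add_apply, ← mul_add]
  gcongr
  linarith

lemma cylShift_eq_zero [SecondCountableTopology E] [CompleteSpace E] [SFinite Γ]
    (hN : Continuous N) (hΓ : IsAdmissible 1 Γ) (hK : ∀ᵐ s ∂Γ, N s = 0 → s = 0)
    (hlog : Integrable (fun s => log (N s) • s) Γ) (him : ∀ u, (specExponent 1 Γ u).im = 0) :
    cylShift N Γ = 0 := by
  refine ext_inner_left ℝ fun u => ?_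
  have hreal : (specExponent 1 (cylProj 1 N Γ) u).im = 0 := by
    refine Complex.conj_eq_iff_im.1 ?_
    rw [← specExponent_map_neg, cylProj_map_neg_eq_self one_pos one_lt_two hN hΓ him]
  rw [specExponent_one_cylProj hN hΓ hK hlog, Complex.add_im, him] at hreal
  simpa using hreal

end Projection

section FiniteDimensional

lemma continuous_seminorm {E : Type*} [NormedAddCommGroup E] [NormedSpace ℝ E]
    [FiniteDimensional ℝ E] (N : Seminorm ℝ E) : Continuous N :=
  N.convexOn.locallyLipschitz.continuous

lemma isFiniteMeasure_of_ae_seminorm_eq_one {E : Type*} [NormedAddCommGroup E] [NormedSpace ℝ E]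
    [MeasurableSpace E] {α : ℝ} (hα₀ : 0 < α) {N : Seminorm ℝ E} (hN : Continuous N)
    {Γ : Measure E} (hΓ : ∀ᵐ s ∂Γ, N s = 1) (hint : Integrable (fun s => ‖s‖ ^ α) Γ) :
    IsFiniteMeasure Γ := by
  obtain ⟨C, hC, hle⟩ := N.bound_of_continuous_normedSpace hN
  have hone : Integrable (fun _ : E => (1 : ℝ)) Γ := by
    refine (hint.const_mul (C ^ α)).mono' aestronglyMeasurable_const (hΓ.mono fun s hs => ?_)
    rw [norm_one, ← mul_rpow hC.le (norm_nonneg s)]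
    exact one_le_rpow (hs ▸ hle s) hα₀.le
  exact (integrable_const_iff.1 hone).resolve_left one_ne_zero

variable {ι : Type*} [Fintype ι]

lemma exists_norm_le_card_mul_abs [Nonempty ι] (x : EuclideanSpace ℝ ι) :
    ∃ i, ‖x‖ ≤ Fintype.card ι * |x i| := by
  obtain ⟨i, hi⟩ := Finite.exists_max fun i => |x i|
  have hcard : (1 : ℝ) ≤ Fintype.card ι := by exact_mod_cast Fintype.card_pos (α := ι)
  refine ⟨i, le_of_sq_le_sq ?_ (by positivity)⟩
  calc ‖x‖ ^ 2 = ∑ j, |x j| ^ 2 := EuclideanSpace.norm_sq_eq x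
    _ ≤ ∑ _j : ι, |x i| ^ 2 := Finset.sum_le_sum fun j _ => pow_le_pow_left₀ (abs_nonneg _) (hi j) 2
    _ = Fintype.card ι * |x i| ^ 2 := by rw [Finset.sum_const, nsmul_eq_mul, Finset.card_univ]
    _ ≤ (Fintype.card ι * |x i|) ^ 2 := by
      rw [mul_pow]
      gcongr
      exact le_self_pow₀ hcard two_ne_zero

lemma apply_norm_le_mul_sum_apply [Nonempty ι] {F : ℝ → ℝ} (hF₀ : ∀ x, 0 ≤ F x)
    (hmono : ∀ x y, |x| ≤ |y| → F x ≤ F y) (hmul : ∀ x y, F (x * y) ≤ F x * F y)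
    (x : EuclideanSpace ℝ ι) : F ‖x‖ ≤ F (Fintype.card ι) * ∑ i, F (x i) := by
  obtain ⟨i, hi⟩ := exists_norm_le_card_mul_abs x
  calc F ‖x‖ ≤ F (Fintype.card ι * x i) :=
        hmono _ _ (by rwa [abs_norm, abs_mul, Nat.abs_cast])
    _ ≤ F (Fintype.card ι) * F (x i) := hmul _ _
    _ ≤ F (Fintype.card ι) * ∑ i, F (x i) := by
      gcongr
      · exact hF₀ _
      · exact Finset.single_le_sum (f := fun i => F (x i)) (fun j _ => hF₀ _) (Finset.mem_univ i)

lemma growth_norm_le [Nonempty ι] {α : ℝ} (hα₀ : 0 < α) (x : EuclideanSpace ℝ ι) :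
    growth α ‖x‖ ≤ growth α (Fintype.card ι) * ∑ i, growth α (x i) :=
  apply_norm_le_mul_sum_apply (growth_nonneg α) (fun _ _ => growth_le_growth hα₀)
    (growth_mul_le α) x

variable {α : ℝ} {Γ : Measure (EuclideanSpace ℝ ι)}

lemma inner_single_left_real [DecidableEq ι] (i : ι) (c : ℝ) (s : EuclideanSpace ℝ ι) :
    ⟪EuclideanSpace.single i c, s⟫_ℝ = c * s i := by
  rw [EuclideanSpace.inner_single_left, conj_trivial]

lemma integrable_norm_rpow_of_integrable_abs_inner [Nonempty ι] (hα₀ : 0 < α)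
    (h : ∀ u, Integrable (fun s => |⟪u, s⟫_ℝ| ^ α) Γ) : Integrable (fun s => ‖s‖ ^ α) Γ := by
  classical
  have hcoord (i : ι) : Integrable (fun s => |s i| ^ α) Γ := by
    simpa only [inner_single_left_real, one_mul] using h (EuclideanSpace.single i 1)
  refine ((integrable_finsetSum Finset.univ fun i _ => hcoord i).const_mul
    (|(Fintype.card ι : ℝ)| ^ α)).mono' (Measurable.aestronglyMeasurable (by fun_prop))
      (ae_of_all _ fun s => ?_)
  rw [norm_of_nonneg (by positivity)]
  have hle := apply_norm_le_mul_sum_apply (F := fun x => |x| ^ α) (fun x => by positivity)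
    (fun x y hxy => rpow_le_rpow (abs_nonneg _) hxy hα₀.le)
    (fun x y => by rw [abs_mul, mul_rpow (abs_nonneg _) (abs_nonneg _)]) s
  rwa [abs_norm] at hle

lemma log_two_mul_abs_le (x : ℝ) :
    log 2 * |x| ≤ |2 * x| * |log (2 * x)| + |x| * |log x| := by
  rcases eq_or_ne x 0 with rfl | hx
  · simp
  have hlog : log 2 ≤ |log (2 * x)| + |log x| := by
    linarith [log_mul two_ne_zero hx, le_abs_self (log (2 * x)), neg_abs_le (log x)]
  have habs : |x| ≤ |2 * x| := by
    rw [abs_mul, abs_two]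
    linarith [abs_nonneg x]
  calc log 2 * |x| ≤ (|log (2 * x)| + |log x|) * |x| := by gcongr
    _ = |x| * |log (2 * x)| + |x| * |log x| := by ring
    _ ≤ |2 * x| * |log (2 * x)| + |x| * |log x| := by gcongr

lemma isAdmissible_of_integrable_inner [Nonempty ι] (hα₀ : 0 < α)
    (hne : α ≠ 1 → ∀ u, Integrable (fun s => |⟪u, s⟫_ℝ| ^ α) Γ)
    (hone : α = 1 → ∀ u, Integrable (fun s => |⟪u, s⟫_ℝ| * |log (|⟪u, s⟫_ℝ|)|) Γ) :
    IsAdmissible α Γ := by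
  classical
  have hcoord (i : ι) : Integrable (fun s => growth α (s i)) Γ := by
    by_cases hα : α = 1
    · subst hα
      have h₁ := hone rfl (EuclideanSpace.single i 1)
      have h₂ := hone rfl (EuclideanSpace.single i 2)
      simp only [inner_single_left_real, one_mul, log_abs] at h₁ h₂
      have habs : Integrable (fun s => log 2 * |s i|) Γ :=
        (h₂.add h₁).mono' (Measurable.aestronglyMeasurable (by fun_prop)) (ae_of_all _ fun s => by
          rw [norm_of_nonneg (by positivity)]
          exact log_two_mul_abs_le (s i))
      simp only [growth_one, mul_one_add]
      exact ((integrable_const_mul_iff (log_pos one_lt_two).ne'.isUnit _).1 habs).add h₁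
    · simpa only [growth_of_ne_one hα, inner_single_left_real, one_mul]
        using hne hα (EuclideanSpace.single i 1)
  refine ((integrable_finsetSum Finset.univ fun i _ => hcoord i).const_mul
    (growth α (Fintype.card ι))).mono'
    ((measurable_growth α).comp measurable_norm).aestronglyMeasurable
      (ae_of_all _ fun s => ?_)
  rw [norm_of_nonneg (growth_nonneg _ _)]
  exact growth_norm_le hα₀ s

end FiniteDimensional

section Representation

variable {m h : ℕ} {α : ℝ} {ν Γ Γ₀ : Measure (PathSpace m h)} {N : Seminorm ℝ (PathSpace m h)}
  {b : PathSpace m h}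

lemma specExponent_im_eq_zero_of_isSymm (hα₀ : 0 < α) (hΓ₀ : IsAdmissible α Γ₀)
    (hν : ∀ u, charFun ν u = Complex.exp (-specExponent α Γ₀ u)) (hs : IsSymm ν)
    (u : PathSpace m h) : (specExponent α Γ₀ u).im = 0 := by
  have hcont := hΓ₀.continuous_specExponent hα₀
  have hneg (u : PathSpace m h) : charFun ν (-u) = charFun ν u := by
    have hmap := charFun_map_smul (μ := ν) (-1) u
    simp only [neg_smul, one_smul] at hmap
    rw [← hmap]
    exact congrArg (charFun · u) hs
  have hconj := eq_of_exp_eq (F := fun u => -specExponent α Γ₀ (-u))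
    (G := fun u => -specExponent α Γ₀ u) (by fun_prop) (by fun_prop) (x₀ := 0) (by rw [neg_zero])
    fun u => by rw [← hν, hneg, hν]
  have hu := neg_injective (congrFun hconj u)
  rwa [specExponent_neg, Complex.conj_eq_iff_im] at hu

namespace IsSpectralRep

lemma isAdmissible (hr : IsSpectralRep α N ν Γ b) (hα₀ : 0 < α) (hs : ¬IsSymm ν) :
    IsAdmissible α Γ :=
  isAdmissible_of_integrable_inner hα₀ (hr.2.2 hs).1 (hr.2.2 hs).2.1

lemma integrable_norm_rpow (hr : IsSpectralRep α N ν Γ b) (hα₀ : 0 < α) :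
    Integrable (fun s => ‖s‖ ^ α) Γ := by
  by_cases hs : IsSymm ν
  · exact integrable_norm_rpow_of_integrable_abs_inner hα₀ (hr.2.1 hs).2.2.1
  · exact (hr.isAdmissible hα₀ hs).integrable_norm_rpow

lemma isFiniteMeasure (hr : IsSpectralRep α N ν Γ b) (hα₀ : 0 < α) : IsFiniteMeasure Γ :=
  isFiniteMeasure_of_ae_seminorm_eq_one hα₀ (continuous_seminorm N) hr.1
    (hr.integrable_norm_rpow hα₀)

lemma specExponent_sub_eq (hr : IsSpectralRep α N ν Γ b) (hα₀ : 0 < α) (hΓ₀ : IsAdmissible α Γ₀)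
    (hν : ∀ u, charFun ν u = Complex.exp (-specExponent α Γ₀ u)) (hs : ¬IsSymm ν)
    (u : PathSpace m h) :
    specExponent α Γ u - Complex.I * ((⟪u, b⟫_ℝ : ℝ) : ℂ) = specExponent α Γ₀ u := by
  have hcont := (hr.isAdmissible hα₀ hs).continuous_specExponent hα₀
  have hcont₀ := hΓ₀.continuous_specExponent hα₀
  have heq := eq_of_exp_eq (F := fun u => -specExponent α Γ u + Complex.I * ((⟪u, b⟫_ℝ : ℝ) : ℂ))
    (G := fun u => -specExponent α Γ₀ u) (by fun_prop) (by fun_prop) (x₀ := 0)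
    (by simp [specExponent_zero hα₀]) fun u => ((hr.2.2 hs).2.2 u).symm.trans (hν u)
  linear_combination -congrFun heq u

lemma integral_abs_inner_eq (hr : IsSpectralRep α N ν Γ b) (hα₀ : 0 < α)
    (hΓ₀ : IsAdmissible α Γ₀) (hν : ∀ u, charFun ν u = Complex.exp (-specExponent α Γ₀ u))
    (u : PathSpace m h) : ∫ s, |⟪u, s⟫_ℝ| ^ α ∂Γ = ∫ s, |⟪u, s⟫_ℝ| ^ α ∂Γ₀ := by
  by_cases hs : IsSymm ν
  · have hnorm := congrArg norm (((hr.2.1 hs).2.2.2 u).symm.trans (hν u))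
    simp only [Complex.norm_exp, Complex.neg_re, Complex.ofReal_re, hΓ₀.specExponent_re hα₀,
      exp_eq_exp, neg_inj] at hnorm
    exact hnorm
  · have hre := congrArg Complex.re (hr.specExponent_sub_eq hα₀ hΓ₀ hν hs u)
    simpa [hΓ₀.specExponent_re hα₀, (hr.isAdmissible hα₀ hs).specExponent_re hα₀] using hre

variable [SFinite Γ₀]

lemma integral_sin_mul_one_sub_cos_eq (hr : IsSpectralRep α N ν Γ b) (hα₀ : 0 < α) (hα₂ : α < 2)
    (hΓ₀ : IsAdmissible α Γ₀) (hν : ∀ u, charFun ν u = Complex.exp (-specExponent α Γ₀ u))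
    (u v : PathSpace m h) :
    ∫ x, sin ⟪u, x⟫_ℝ * (1 - cos ⟪v, x⟫_ℝ) ∂(levyMeasure α Γ)
      = ∫ x, sin ⟪u, x⟫_ℝ * (1 - cos ⟪v, x⟫_ℝ) ∂(levyMeasure α Γ₀) := by
  have := hr.isFiniteMeasure hα₀
  obtain ⟨c, hc⟩ := exists_integral_sin_mul_one_sub_cos_levyMeasure (E := PathSpace m h) hα₀ hα₂
  rw [hc Γ₀ hΓ₀]
  by_cases hs : IsSymm ν
  · rw [integral_sin_mul_one_sub_cos_levyMeasure_of_symm hα₀ hα₂ (hr.integrable_norm_rpow hα₀)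
      (hr.2.1 hs).1]
    simp only [specExponent_im_eq_zero_of_isSymm hα₀ hΓ₀ hν hs, secondDiff]
    simp
  · rw [hc Γ (hr.isAdmissible hα₀ hs)]
    simp only [← hr.specExponent_sub_eq hα₀ hΓ₀ hν hs, secondDiff, Complex.sub_im,
      Complex.I_mul_im, Complex.ofReal_re, inner_add_left, inner_sub_left]
    ring

lemma restrict_levyMeasure_eq (hr : IsSpectralRep α N ν Γ b) (hα₀ : 0 < α) (hα₂ : α < 2)
    (hΓ₀ : IsAdmissible α Γ₀) (hν : ∀ u, charFun ν u = Complex.exp (-specExponent α Γ₀ u)) :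
    (levyMeasure α Γ).restrict {0}ᶜ = (levyMeasure α Γ₀).restrict {0}ᶜ := by
  have := hr.isFiniteMeasure hα₀
  exact StableAgg.restrict_levyMeasure_eq hα₀ hα₂ (hr.integrable_norm_rpow hα₀)
    hΓ₀.integrable_norm_rpow (hr.integral_abs_inner_eq hα₀ hΓ₀ hν)
    (hr.integral_sin_mul_one_sub_cos_eq hα₀ hα₂ hΓ₀ hν)

lemma eq_cylProj (hr : IsSpectralRep α N ν Γ b) (hα₀ : 0 < α) (hα₂ : α < 2)
    (hΓ₀ : IsAdmissible α Γ₀) (hν : ∀ u, charFun ν u = Complex.exp (-specExponent α Γ₀ u)) :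
    Γ = cylProj α N Γ₀ := by
  rw [← cylProj_eq_of_restrict_levyMeasure_eq hα₀ (continuous_seminorm N)
    (hr.restrict_levyMeasure_eq hα₀ hα₂ hΓ₀ hν), cylProj_eq_self hr.1]

lemma ae_eq_zero_of_seminorm_eq_zero (hr : IsSpectralRep α N ν Γ b) (hα₀ : 0 < α) (hα₂ : α < 2)
    (hΓ₀ : IsAdmissible α Γ₀) (hν : ∀ u, charFun ν u = Complex.exp (-specExponent α Γ₀ u)) :
    ∀ᵐ s ∂Γ₀, N s = 0 → s = 0 := by
  have hcyl : ∀ᵐ s ∂Γ, N s = 1 := hr.1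
  refine ae_eq_zero_of_seminorm_eq_zero_of_restrict_levyMeasure_eq hα₀ (continuous_seminorm N)
    (hr.restrict_levyMeasure_eq hα₀ hα₂ hΓ₀ hν) (hcyl.mono fun s hs hs₀ => ?_)
  exact absurd (hs₀.symm.trans hs) zero_ne_one

end IsSpectralRep

lemma isSpectralRep_cylProj_of_isSymm [SFinite Γ₀] (hα₀ : 0 < α) (hα₂ : α < 2)
    (hΓ₀ : IsAdmissible α Γ₀) (hν : ∀ u, charFun ν u = Complex.exp (-specExponent α Γ₀ u))
    (hK : ∀ᵐ s ∂Γ₀, N s = 0 → s = 0) (hs : IsSymm ν) :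
    IsSpectralRep α N ν (cylProj α N Γ₀) 0 := by
  have hN := continuous_seminorm N
  have him := specExponent_im_eq_zero_of_isSymm hα₀ hΓ₀ hν hs
  refine ⟨ae_cylProj_eq_one hα₀ hN Γ₀, fun _ => ⟨cylProj_map_neg_eq_self hα₀ hα₂ hN hΓ₀ him, rfl,
    integrable_abs_inner_cylProj hα₀ hN hK hΓ₀.integrable_norm_rpow, fun u => ?_⟩,
    fun hns => absurd hs hns⟩
  rw [integral_abs_inner_cylProj hN hK, hν, ← hΓ₀.specExponent_re hα₀]
  congr 2
  exact Complex.ext rfl (him u)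

lemma isSpectralRep_cylProj_of_ne_one (hα₀ : 0 < α) (hα : α ≠ 1) (hΓ₀ : IsAdmissible α Γ₀)
    (hν : ∀ u, charFun ν u = Complex.exp (-specExponent α Γ₀ u))
    (hK : ∀ᵐ s ∂Γ₀, N s = 0 → s = 0) (hs : ¬IsSymm ν) :
    IsSpectralRep α N ν (cylProj α N Γ₀) 0 := by
  have hN := continuous_seminorm N
  refine ⟨ae_cylProj_eq_one hα₀ hN Γ₀, fun hsymm => absurd hsymm hs, fun _ =>
    ⟨fun _ => integrable_abs_inner_cylProj hα₀ hN hK hΓ₀.integrable_norm_rpow,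
      fun hone => absurd hone hα, fun u => ?_⟩⟩
  change _ = Complex.exp (-specExponent α (cylProj α N Γ₀) u + _)
  rw [specExponent_cylProj hα₀ hα hN hK, hν, inner_zero_right, Complex.ofReal_zero, mul_zero,
    add_zero]

lemma isSpectralRep_cylProj_one (hΓ₀ : IsAdmissible 1 Γ₀)
    (hν : ∀ u, charFun ν u = Complex.exp (-specExponent 1 Γ₀ u))
    (hK : ∀ᵐ s ∂Γ₀, N s = 0 → s = 0) (hs : ¬IsSymm ν)
    (hlog : Integrable (fun s => ‖s‖ * |log (N s / ‖s‖)|) Γ₀) :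
    IsSpectralRep 1 N ν (cylProj 1 N Γ₀) (cylShift N Γ₀) := by
  have hN := continuous_seminorm N
  have hadm := (isAdmissible_one_cylProj_iff hN hΓ₀ hK).2 hlog
  refine ⟨ae_cylProj_eq_one one_pos hN Γ₀, fun hsymm => absurd hsymm hs, fun _ =>
    ⟨fun hne => absurd rfl hne, fun _ u => ?_, fun u => ?_⟩⟩
  · refine (hadm.integrable_growth_inner one_pos u).mono'
      (Measurable.aestronglyMeasurable (by fun_prop)) (ae_of_all _ fun s => ?_)
    rw [growth_one, norm_of_nonneg (by positivity), log_abs]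
    gcongr
    exact le_add_of_nonneg_left zero_le_one
  · change _ = Complex.exp (-specExponent 1 (cylProj 1 N Γ₀) u + _)
    rw [specExponent_one_cylProj hN hΓ₀ hK
      (integrable_log_smul_of_integrable_log_div hN hΓ₀ hK hlog), hν]
    congr 1
    ring

end Representation

section Representability

variable {m h : ℕ} {α : ℝ} {ν Γ Γ' Γ₀ : Measure (PathSpace m h)}
  {N : Seminorm ℝ (PathSpace m h)} {b b' : PathSpace m h}

lemma IsSpectralRep.shift_unique (hr : IsSpectralRep α N ν Γ b) (hr' : IsSpectralRep α N ν Γ b')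
    (hα₀ : 0 < α) (hΓ₀ : IsAdmissible α Γ₀)
    (hν : ∀ u, charFun ν u = Complex.exp (-specExponent α Γ₀ u)) : b = b' := by
  by_cases hs : IsSymm ν
  · rw [(hr.2.1 hs).2.1, (hr'.2.1 hs).2.1]
  · refine ext_inner_left ℝ fun u => Complex.ofReal_injective ?_
    have hu := (hr.specExponent_sub_eq hα₀ hΓ₀ hν hs u).trans
      (hr'.specExponent_sub_eq hα₀ hΓ₀ hν hs u).symm
    exact mul_left_cancel₀ Complex.I_ne_zero (sub_right_injective hu)

variable [SFinite Γ₀]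

lemma IsSpectralRep.isSpectralRep_iff (hr : IsSpectralRep α N ν Γ b) (hα₀ : 0 < α) (hα₂ : α < 2)
    (hΓ₀ : IsAdmissible α Γ₀) (hν : ∀ u, charFun ν u = Complex.exp (-specExponent α Γ₀ u)) :
    IsSpectralRep α N ν Γ' b' ↔ Γ' = Γ ∧ b' = b := by
  refine ⟨fun hr' => ?_, fun ⟨hΓ, hb⟩ => hΓ ▸ hb ▸ hr⟩
  have hΓ : Γ' = Γ :=
    (hr'.eq_cylProj hα₀ hα₂ hΓ₀ hν).trans (hr.eq_cylProj hα₀ hα₂ hΓ₀ hν).symm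
  subst hΓ
  exact ⟨rfl, hr'.shift_unique hr hα₀ hΓ₀ hν⟩

lemma isRepresentable_iff (hα₀ : 0 < α) (hα₂ : α < 2) (hΓ₀ : IsAdmissible α Γ₀)
    (hν : ∀ u, charFun ν u = Complex.exp (-specExponent α Γ₀ u)) :
    IsRepresentable α N ν ↔ (∀ᵐ s ∂Γ₀, N s = 0 → s = 0) ∧
      (α = 1 → ¬IsSymm ν → Integrable (fun s => ‖s‖ * |log (N s / ‖s‖)|) Γ₀) := by
  constructor
  · rintro ⟨Γ, b, hr⟩
    have hK := hr.ae_eq_zero_of_seminorm_eq_zero hα₀ hα₂ hΓ₀ hν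
    refine ⟨hK, ?_⟩
    rintro rfl hs
    rw [← isAdmissible_one_cylProj_iff (continuous_seminorm N) hΓ₀ hK,
      ← hr.eq_cylProj hα₀ hα₂ hΓ₀ hν]
    exact hr.isAdmissible hα₀ hs
  · rintro ⟨hK, hlog⟩
    by_cases hs : IsSymm ν
    · exact ⟨_, _, isSpectralRep_cylProj_of_isSymm hα₀ hα₂ hΓ₀ hν hK hs⟩
    by_cases hα : α = 1
    · subst hα
      exact ⟨_, _, isSpectralRep_cylProj_one hΓ₀ hν hK hs (hlog rfl hs)⟩
    · exact ⟨_, _, isSpectralRep_cylProj_of_ne_one hα₀ hα hΓ₀ hν hK hs⟩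

end Representability

section SkewAtoms

variable {κ E : Type*}

/-- The measure with mass `c k` at the point `x k`; a negative `c k` counts as zero. -/
def weightedDirac [MeasurableSpace E] (c : κ → ℝ) (x : κ → E) : Measure E :=
  Measure.sum fun k => ENNReal.ofReal (c k) • Measure.dirac (x k)

/-- The spectral measure of a series `∑ₖ εₖ xₖ` with independent errors `εₖ` of law
`S(α, b k, 1, 0)`: it has masses `(1 ± b k) / 2` at the points `± x k`. -/
def skewAtoms [Neg E] [MeasurableSpace E] (b : κ → ℝ) (x : κ → E) : Measure E :=
  weightedDirac (fun k => (1 + b k) / 2) x + weightedDirac (fun k => (1 - b k) / 2) fun k => -x k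

section WeightedDirac

variable [Countable κ] [MeasurableSpace E] {c : κ → ℝ} {x : κ → E} {F : Type*}
  [NormedAddCommGroup F] {f : E → F}

instance : SFinite (weightedDirac c x) := by
  unfold weightedDirac
  have (k : κ) : SFinite (ENNReal.ofReal (c k) • Measure.dirac (x k)) := inferInstance
  infer_instance

lemma ae_weightedDirac_iff {P : E → Prop} (hP : MeasurableSet {s | P s}) :
    (∀ᵐ s ∂weightedDirac c x, P s) ↔ ∀ k, 0 < c k → P (x k) := by
  refine Measure.ae_sum_iff.trans (forall_congr' fun k => ?_)
  by_cases hk : 0 < c k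
  · rw [Measure.ae_ennreal_smul_measure_iff (ENNReal.ofReal_pos.2 hk).ne', ae_dirac_iff hP,
      imp_iff_right hk]
  · simp [hk, ENNReal.ofReal_of_nonpos (not_lt.1 hk)]

variable [MeasurableSingletonClass E]

lemma integrable_weightedDirac_iff (hc : ∀ k, 0 ≤ c k) :
    Integrable f (weightedDirac c x) ↔ Summable fun k => c k * ‖f (x k)‖ := by
  rw [weightedDirac, integrable_sum_dirac_iff fun _ => ENNReal.ofReal_ne_top]
  simp only [ENNReal.toReal_ofReal (hc _)]

lemma hasSum_integral_weightedDirac [NormedSpace ℝ F] [CompleteSpace F] (hc : ∀ k, 0 ≤ c k)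
    (hf : Integrable f (weightedDirac c x)) :
    HasSum (fun k => c k • f (x k)) (∫ s, f s ∂weightedDirac c x) := by
  have hsum := (integrable_sum_dirac_iff fun _ => ENNReal.ofReal_ne_top).1 hf
  simpa only [ENNReal.toReal_ofReal (hc _), weightedDirac] using
    hasSum_integral_sum_dirac (fun _ => ENNReal.ofReal_ne_top) hsum

end WeightedDirac

section NullSets

variable [Countable κ] [MeasurableSpace E] [Neg E] {b : κ → ℝ} {x : κ → E}

instance : SFinite (skewAtoms b x) := by
  unfold skewAtoms
  infer_instance

lemma ae_skewAtoms_iff {P : E → Prop} (hP : MeasurableSet {s | P s}) (hneg : ∀ s, P (-s) ↔ P s) :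
    (∀ᵐ s ∂skewAtoms b x, P s) ↔ ∀ k, P (x k) := by
  rw [skewAtoms, ae_add_measure_iff, ae_weightedDirac_iff hP, ae_weightedDirac_iff hP,
    ← forall_and]
  refine forall_congr' fun k => ?_
  rw [hneg, ← or_imp, imp_iff_right]
  by_contra! hk
  linarith [hk.1, hk.2]

end NullSets

section Projection

variable [NormedAddCommGroup E] [InnerProductSpace ℝ E] [MeasurableSpace E] [BorelSpace E] {α : ℝ}
  {N : Seminorm ℝ E} {b : κ → ℝ} {x : κ → E}

lemma cylProj_weightedDirac (hN : Continuous N) {c : κ → ℝ} (hc : ∀ k, 0 ≤ c k) :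
    cylProj α N (weightedDirac c x)
      = weightedDirac (fun k => c k * N (x k) ^ α) fun k => (N (x k))⁻¹ • x k := by
  rw [cylProj, weightedDirac, withDensity_sum,
    Measure.map_sum (measurable_radialProj hN).aemeasurable, weightedDirac]
  congr 1 with k : 1
  rw [withDensity_smul_measure, dirac_withDensity, Measure.map_smul, Measure.map_smul,
    Measure.map_dirac, smul_smul, ENNReal.ofReal_mul (hc k), radialProj]

lemma cylProj_skewAtoms (hN : Continuous N) (hb : ∀ k, |b k| ≤ 1) :
    cylProj α N (skewAtoms b x)
      = weightedDirac (fun k => (1 + b k) / 2 * N (x k) ^ α) (fun k => (N (x k))⁻¹ • x k)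
        + weightedDirac (fun k => (1 - b k) / 2 * N (x k) ^ α) fun k => -(N (x k))⁻¹ • x k := by
  have hadd (Γ₁ Γ₂ : Measure E) : cylProj α N (Γ₁ + Γ₂) = cylProj α N Γ₁ + cylProj α N Γ₂ := by
    rw [cylProj, withDensity_add_measure, Measure.map_add _ _ (measurable_radialProj hN), cylProj,
      cylProj]
  rw [skewAtoms, hadd, cylProj_weightedDirac hN fun k => by linarith [neg_le_of_abs_le (hb k)],
    cylProj_weightedDirac hN fun k => by linarith [le_of_abs_le (hb k)]]
  simp only [map_neg_eq_map, smul_neg, neg_smul]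

end Projection

variable [Countable κ] [NormedAddCommGroup E] [MeasurableSpace E] [BorelSpace E] {b : κ → ℝ}
  {x : κ → E}

section Integral

variable {F : Type*} [NormedAddCommGroup F] {f : E → F}

lemma integrable_skewAtoms_iff (hb : ∀ k, |b k| ≤ 1) (hf : ∀ s, ‖f (-s)‖ = ‖f s‖) :
    Integrable f (skewAtoms b x) ↔ Summable fun k => ‖f (x k)‖ := by
  have hpos (k : κ) : 0 ≤ (1 + b k) / 2 := by linarith [neg_le_of_abs_le (hb k)]
  have hneg (k : κ) : 0 ≤ (1 - b k) / 2 := by linarith [le_of_abs_le (hb k)]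
  rw [skewAtoms, integrable_add_measure, integrable_weightedDirac_iff hpos,
    integrable_weightedDirac_iff hneg]
  simp only [hf]
  refine ⟨fun ⟨h₁, h₂⟩ => (h₁.add h₂).congr fun k => by ring, fun hs => ⟨?_, ?_⟩⟩
  · exact hs.of_nonneg_of_le (fun k => mul_nonneg (hpos k) (norm_nonneg _)) fun k =>
      mul_le_of_le_one_left (norm_nonneg _) (by linarith [hneg k])
  · exact hs.of_nonneg_of_le (fun k => mul_nonneg (hneg k) (norm_nonneg _)) fun k =>
      mul_le_of_le_one_left (norm_nonneg _) (by linarith [hpos k])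

lemma hasSum_integral_skewAtoms [NormedSpace ℝ F] [CompleteSpace F] (hb : ∀ k, |b k| ≤ 1)
    (hf : Integrable f (skewAtoms b x)) :
    HasSum (fun k => ((1 + b k) / 2) • f (x k) + ((1 - b k) / 2) • f (-x k))
      (∫ s, f s ∂skewAtoms b x) := by
  obtain ⟨h₁, h₂⟩ := integrable_add_measure.1 hf
  rw [skewAtoms, integral_add_measure h₁ h₂]
  exact (hasSum_integral_weightedDirac (fun k => by linarith [neg_le_of_abs_le (hb k)]) h₁).add
    (hasSum_integral_weightedDirac (fun k => by linarith [le_of_abs_le (hb k)]) h₂)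

end Integral

variable {α : ℝ}

lemma isAdmissible_skewAtoms_iff (hb : ∀ k, |b k| ≤ 1) :
    IsAdmissible α (skewAtoms b x) ↔ Summable fun k => growth α ‖x k‖ := by
  rw [IsAdmissible, integrable_skewAtoms_iff hb fun s => by rw [norm_neg]]
  simp only [norm_of_nonneg (growth_nonneg _ _)]

lemma smul_stableExponent_add_smul_stableExponent_neg (α β x : ℝ) :
    ((1 + β) / 2) • stableExponent α 1 x + ((1 - β) / 2) • stableExponent α 1 (-x)
      = stableExponent α β x := by
  rw [stableExponent_neg]
  apply Complex.ext
  · simp only [Complex.add_re, Complex.smul_re, Complex.conj_re, stableExponent_re, smul_eq_mul]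
    ring
  · simp only [Complex.add_im, Complex.smul_im, Complex.conj_im, stableExponent_im, smul_eq_mul]
    ring

lemma abs_smul_stableExponent_sign_mul_im (α β x : ℝ) :
    (|β| • stableExponent α 1 ((SignType.sign β : ℝ) * x)).im = (stableExponent α β x).im := by
  rw [Complex.smul_im, stableExponent_im, stableExponent_im, smul_eq_mul]
  obtain hβ | rfl | hβ := lt_trichotomy β 0
  · have hsign : (SignType.sign β : ℝ) = -1 := by simp [hβ]
    simp only [hsign, neg_one_mul, abs_neg, abs_of_neg hβ, Left.sign_neg, SignType.coe_neg, w]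
    ring
  · simp
  · simp only [sign_pos hβ, SignType.coe_one, one_mul, abs_of_pos hβ]
    ring

variable [InnerProductSpace ℝ E] {N : Seminorm ℝ E}

lemma hasSum_specExponent_skewAtoms (hα₀ : 0 < α) (hb : ∀ k, |b k| ≤ 1)
    (hx : IsAdmissible α (skewAtoms b x)) (u : E) :
    HasSum (fun k => stableExponent α (b k) ⟪u, x k⟫_ℝ) (specExponent α (skewAtoms b x) u) := by
  have hsum := hasSum_integral_skewAtoms hb (hx.integrable_stableExponent hα₀ u)
  simpa only [inner_neg_right, smul_stableExponent_add_smul_stableExponent_neg, specExponent]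
    using hsum

lemma hasSum_cylShift_skewAtoms [CompleteSpace E] (hb : ∀ k, |b k| ≤ 1)
    (hlog : Integrable (fun s => log (N s) • s) (skewAtoms b x)) :
    HasSum (fun k => (-(2 / π) * (b k * log (N (x k)))) • x k) (cylShift N (skewAtoms b x)) := by
  rw [cylShift]
  convert (hasSum_integral_skewAtoms hb hlog).const_smul (-(2 / π)) using 2 with k
  rw [map_neg_eq_map]
  module

lemma measurableSet_eq_zero_imp_eq_zero (hN : Continuous N) :
    MeasurableSet {s : E | N s = 0 → s = 0} := by
  simp only [imp_iff_not_or, Set.ofPred_or]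
  exact (measurableSet_eq_fun hN.measurable measurable_const).compl.union
    (measurableSet_singleton (0 : E))

-- The atoms of `skewAtoms b x` may fail the integrability of `log (N s) • s` where `b k = 0`; the
-- measure with masses `|b k|` at `sign (b k) • x k` gives an exponent with the same imaginary part.
lemma tsum_log_smul_eq_zero [SecondCountableTopology E] [CompleteSpace E] (hN : Continuous N)
    (hb : ∀ k, |b k| ≤ 1) (hx : IsAdmissible 1 (skewAtoms b x))
    (hK : ∀ k, N (x k) = 0 → x k = 0) (hlog : Summable fun k => ‖(b k * log (N (x k))) • x k‖)
    (him : ∀ u, (specExponent 1 (skewAtoms b x) u).im = 0) :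
    ∑' k, (b k * log (N (x k))) • x k = 0 := by
  set Γ := weightedDirac (fun k => |b k|) fun k => (SignType.sign (b k) : ℝ) • x k
  have habs (k : κ) : 0 ≤ |b k| := abs_nonneg _
  have hterm (k : κ) : |b k| • (log (N ((SignType.sign (b k) : ℝ) • x k)) •
      (SignType.sign (b k) : ℝ) • x k) = (b k * log (N (x k))) • x k := by
    obtain hk | hk | hk := lt_trichotomy (b k) 0 <;> simp [hk, smul_smul, abs_of_neg, abs_of_pos]
  have hadm : IsAdmissible 1 Γ := by
    refine (integrable_weightedDirac_iff habs).2 <|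
      ((isAdmissible_skewAtoms_iff hb).1 hx).of_nonneg_of_le
        (fun k => mul_nonneg (habs k) (norm_nonneg _)) fun k => ?_
    rw [norm_of_nonneg (growth_nonneg _ _)]
    refine (mul_le_of_le_one_left (growth_nonneg _ _) (hb k)).trans (growth_le_growth one_pos ?_)
    obtain hk | hk | hk := lt_trichotomy (b k) 0 <;> simp [hk]
  have hlogΓ : Integrable (fun s => log (N s) • s) Γ := by
    refine (integrable_weightedDirac_iff habs).2 (hlog.congr fun k => ?_)
    rw [← hterm, norm_smul, norm_of_nonneg (habs k)]
  have himΓ (u : E) : (specExponent 1 Γ u).im = 0 := by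
    have hΓu := Complex.hasSum_im (hasSum_integral_weightedDirac habs
      (hadm.integrable_stableExponent one_pos u))
    have hxu := Complex.hasSum_im (hasSum_specExponent_skewAtoms one_pos hb hx u)
    rw [him u] at hxu
    refine hΓu.unique (by
      simpa only [inner_smul_right, abs_smul_stableExponent_sign_mul_im] using hxu)
  have hKΓ : ∀ᵐ s ∂Γ, N s = 0 → s = 0 := by
    refine (ae_weightedDirac_iff (measurableSet_eq_zero_imp_eq_zero hN)).2 fun k hk => ?_
    obtain hk | hk := (abs_pos.1 hk).lt_or_gt <;> simpa [hk] using hK k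
  have hzero := cylShift_eq_zero hN hadm hKΓ hlogΓ himΓ
  have hsum := hasSum_integral_weightedDirac habs hlogΓ
  simp only [hterm] at hsum
  rw [hsum.tsum_eq]
  exact (smul_eq_zero.1 hzero).resolve_left (by simp [pi_ne_zero])

end SkewAtoms

section StableSeries

variable {Ω κ : Type*} [MeasurableSpace Ω] {μ : Measure Ω} {α : ℝ} {b : κ → ℝ} {Y : κ → Ω → ℝ}

section CharFun

variable {E : Type*} [NormedAddCommGroup E] [InnerProductSpace ℝ E] [MeasurableSpace E]
  [BorelSpace E]

lemma tendsto_charFun_map [IsFiniteMeasure μ] {ι : Type*} {l : Filter ι} [l.IsCountablyGenerated]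
    {Z : ι → Ω → E} {Z' : Ω → E} (hZ : ∀ i, AEMeasurable (Z i) μ) (hZ' : AEMeasurable Z' μ)
    (hlim : ∀ᵐ ω ∂μ, Tendsto (fun i => Z i ω) l (𝓝 (Z' ω))) (u : E) :
    Tendsto (fun i => charFun (μ.map (Z i)) u) l (𝓝 (charFun (μ.map Z') u)) := by
  have hexp : Continuous fun z : E => Complex.exp (⟪z, u⟫_ℝ * Complex.I) := by fun_prop
  simp only [charFun_apply, integral_map (hZ _) hexp.aestronglyMeasurable,
    integral_map hZ' hexp.aestronglyMeasurable]
  refine tendsto_integral_filter_of_dominated_convergence (fun _ => 1)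
    (.of_forall fun i => (hexp.measurable.comp_aemeasurable (hZ i)).aestronglyMeasurable)
    (.of_forall fun i => ae_of_all _ fun ω => (Complex.norm_exp_ofReal_mul_I _).le)
    (integrable_const _) ?_
  filter_upwards [hlim] with ω hω using (hexp.tendsto _).comp hω

variable [SecondCountableTopology E]

lemma charFun_map_smul_const {y : Ω → ℝ} (hy : AEMeasurable y μ) (x u : E) :
    charFun (μ.map fun ω => y ω • x) u = charFun (μ.map y) ⟪u, x⟫_ℝ := by
  rw [charFun_apply, charFun_apply, integral_map (by fun_prop) (by fun_prop),
    integral_map hy (by fun_prop)]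
  simp only [real_inner_smul_left, real_inner_comm u x, RCLike.inner_apply, conj_trivial,
    mul_comm ⟪u, x⟫_ℝ]

lemma charFun_map_sum_smul_of_iIndepFun (hY : ∀ k, Measurable (Y k))
    (hind : iIndepFun Y μ) (hlaw : ∀ k, IsStdStableLaw α (b k) (μ.map (Y k))) (x : κ → E)
    (s : Finset κ) (u : E) :
    charFun (μ.map fun ω => ∑ k ∈ s, Y k ω • x k) u
      = Complex.exp (-∑ k ∈ s, stableExponent α (b k) ⟪u, x k⟫_ℝ) := by
  have hindx : iIndepFun (fun k ω => Y k ω • x k) μ :=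
    hind.comp (fun k y => y • x k) fun k => by fun_prop
  rw [iIndepFun.charFun_map_fun_finsetSum_eq_prod (X := fun k ω => Y k ω • x k)
    (fun k _ => by fun_prop) (hindx.restrict s), Finset.prod_apply,
    ← Finset.sum_neg_distrib, Complex.exp_sum]
  exact Finset.prod_congr rfl fun k _ => by
    rw [charFun_map_smul_const (hY k).aemeasurable, hlaw]

variable [Countable κ] {x : κ → E} {Z : Ω → E}

lemma aemeasurable_of_hasSum_smul (hY : ∀ k, Measurable (Y k))
    (hZ : ∀ᵐ ω ∂μ, HasSum (fun k => Y k ω • x k) (Z ω)) : AEMeasurable Z μ :=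
  aemeasurable_of_tendsto_metrizable_ae (atTop : Filter (Finset κ))
    (f := fun s ω => ∑ k ∈ s, Y k ω • x k) (fun s => by fun_prop) hZ

lemma charFun_map_of_hasSum_smul [IsProbabilityMeasure μ] (hα₀ : 0 < α) (hb : ∀ k, |b k| ≤ 1)
    (hY : ∀ k, Measurable (Y k)) (hind : iIndepFun Y μ)
    (hlaw : ∀ k, IsStdStableLaw α (b k) (μ.map (Y k))) (hx : IsAdmissible α (skewAtoms b x))
    (hZ : ∀ᵐ ω ∂μ, HasSum (fun k => Y k ω • x k) (Z ω)) (u : E) :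
    charFun (μ.map Z) u = Complex.exp (-specExponent α (skewAtoms b x) u) := by
  have hlim := tendsto_charFun_map (l := (atTop : Filter (Finset κ)))
    (Z := fun s ω => ∑ k ∈ s, Y k ω • x k) (fun s => by fun_prop)
    (aemeasurable_of_hasSum_smul hY hZ) hZ u
  simp only [charFun_map_sum_smul_of_iIndepFun hY hind hlaw] at hlim
  have hsum := hasSum_specExponent_skewAtoms hα₀ hb hx u
  exact tendsto_nhds_unique hlim ((Complex.continuous_exp.tendsto _).comp (Tendsto.neg hsum))

end CharFun

lemma isCountablyGenerated_cofinite [Countable κ] : (cofinite : Filter κ).IsCountablyGenerated :=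
  HasCountableBasis.isCountablyGenerated
    ⟨hasBasis_cofinite, Countable.ofPred_finite⟩

-- The characteristic function of `d k * Y k` at `1` has modulus `exp (-|d k| ^ α)`.
lemma tendsto_zero_of_hasSum_mul [Countable κ] [IsProbabilityMeasure μ] (hα₀ : 0 < α)
    (hY : ∀ k, Measurable (Y k)) (hlaw : ∀ k, IsStdStableLaw α (b k) (μ.map (Y k))) {d : κ → ℝ}
    {Z : Ω → ℝ} (hZ : ∀ᵐ ω ∂μ, HasSum (fun k => d k * Y k ω) (Z ω)) :
    Tendsto d cofinite (𝓝 0) := by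
  have := isCountablyGenerated_cofinite (κ := κ)
  have hlim := (tendsto_charFun_map (Z := fun k ω => d k * Y k ω) (Z' := fun _ => 0)
    (fun k => by fun_prop) aemeasurable_const
    (hZ.mono fun ω hω => hω.summable.tendsto_cofinite_zero) 1).norm
  have hnorm (k : κ) : ‖charFun (μ.map fun ω => d k * Y k ω) 1‖ = exp (-|d k| ^ α) := by
    rw [charFun_map_mul_comp (hY k).aemeasurable, mul_one, hlaw, Complex.norm_exp, Complex.neg_re,
      stableExponent_re]
  simp only [hnorm, Measure.map_const, measure_univ, one_smul, charFun_dirac, inner_zero_left,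
    Complex.ofReal_zero, zero_mul, Complex.exp_zero, norm_one] at hlim
  have hlog := ((continuousAt_log one_ne_zero).tendsto.comp hlim).neg
  simp only [Function.comp_def, log_exp, log_one, neg_neg, neg_zero] at hlog
  have hroot := hlog.rpow_const (p := α⁻¹) (.inr (inv_pos.2 hα₀).le)
  simp only [rpow_rpow_inv (abs_nonneg _) hα₀.ne', zero_rpow (inv_pos.2 hα₀).ne'] at hroot
  exact (tendsto_zero_iff_abs_tendsto_zero d).2 hroot

end StableSeries

section Growth

variable {κ : Type*} {α : ℝ} {d : κ → ℝ}

lemma growth_le_mul_rpow {s x : ℝ} (hs : 0 < s) (hsα : s < α) (hx : |x| ≤ 1) :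
    growth α x ≤ (1 + 1 / (α - s)) * |x| ^ s := by
  have hαs : 0 < α - s := sub_pos.2 hsα
  obtain h0 | h0 := (abs_nonneg x).eq_or_lt
  · rw [growth, ← h0, zero_rpow (hs.trans hsα).ne', zero_rpow hs.ne', zero_mul, mul_zero]
  have hlog : |x| ^ (α - s) * |log x| ≤ 1 / (α - s) := by
    have hlt := abs_log_mul_self_rpow_lt _ _ h0 hx hαs
    rw [log_abs, abs_mul, abs_of_nonneg (rpow_nonneg h0.le _), mul_comm] at hlt
    exact hlt.le
  have hle : (if α = 1 then 1 + |log x| else 1) ≤ 1 + |log x| := by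
    split_ifs
    · exact le_rfl
    · linarith [abs_nonneg (log x)]
  calc growth α x ≤ |x| ^ α * (1 + |log x|) := by unfold growth; gcongr
    _ = |x| ^ s * (|x| ^ (α - s) + |x| ^ (α - s) * |log x|) := by
      rw [← sub_add_cancel α s, rpow_add h0, add_sub_cancel_right]
      ring
    _ ≤ |x| ^ s * (1 + 1 / (α - s)) := by
      gcongr
      exact rpow_le_one h0.le hx hαs.le
    _ = (1 + 1 / (α - s)) * |x| ^ s := mul_comm _ _

lemma summable_growth_of_rpow {s : ℝ} (hs : 0 < s) (hsα : s < α)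
    (hsum : Summable fun k => |d k| ^ s) : Summable fun k => growth α (d k) := by
  refine .of_norm_bounded_eventually (hsum.mul_left (1 + 1 / (α - s))) ?_
  filter_upwards [hsum.tendsto_cofinite_zero.eventually (ge_mem_nhds one_pos)] with k hk
  rw [norm_of_nonneg (growth_nonneg _ _)]
  exact growth_le_mul_rpow hs hsα (not_lt.1 fun hlt => hk.not_gt (one_lt_rpow hlt hs))

lemma summable_growth_one_of_log (hd : Tendsto d cofinite (𝓝 0))
    (hsum : Summable fun k => |d k| * |log (|d k|)|) : Summable fun k => growth 1 (d k) := by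
  refine .of_norm_bounded_eventually (hsum.mul_left 2) ?_
  have habs := (tendsto_zero_iff_abs_tendsto_zero d).1 hd
  filter_upwards [habs.eventually (gt_mem_nhds (exp_pos (-1)))] with k hk
  rw [norm_of_nonneg (growth_nonneg _ _), growth_one, ← log_abs]
  obtain h0 | h0 := (abs_nonneg (d k)).eq_or_lt
  · simp [← h0]
  have hlog : log (|d k|) < -1 := (log_lt_iff_lt_exp h0).2 hk
  have hone : 1 ≤ |log (|d k|)| := by
    rw [abs_of_neg (by linarith)]
    linarith
  linarith [mul_le_mul_of_nonneg_left hone h0.le]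

lemma CoeffCondition.summable_growth {β : ℝ} {d : ℤ → ℝ} (hd : CoeffCondition α β d)
    (hlim : Tendsto d cofinite (𝓝 0)) : Summable fun k => growth α (d k) := by
  by_cases hαβ : α ≠ 1 ∨ β = 0
  · obtain ⟨s, hs, hsα, -, hsum⟩ := hd.summable_rpow hαβ
    exact summable_growth_of_rpow hs hsα hsum
  · obtain ⟨rfl, hβ⟩ : α = 1 ∧ β ≠ 0 := by simpa using hαβ
    exact summable_growth_one_of_log hlim (hd.summable_log rfl hβ)

lemma summable_growth_coeffVec (hα₀ : 0 < α) {d : ℤ → ℝ} (hd : Summable fun k => growth α (d k))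
    (m h : ℕ) : Summable fun k => growth α ‖coeffVec d m h k‖ := by
  have hcoord (i : Fin (m + h + 1)) : Summable fun k => growth α (coeffVec d m h k i) := by
    refine ((Equiv.addRight ((m : ℤ) - (i : ℕ))).summable_iff.2 hd).congr fun k => ?_
    simp only [Function.comp_apply, Equiv.coe_addRight, coeffVec, add_sub_assoc]
  exact .of_nonneg_of_le (fun k => growth_nonneg _ _) (fun k => growth_norm_le hα₀ _)
    ((summable_sum fun i _ => hcoord i).mul_left _)

end Growth

section FiniteProducts

variable {ι κ G : Type*}

lemma hasSum_prod_of_forall [Fintype ι] [AddCommMonoid G] [TopologicalSpace G] [ContinuousAdd G]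
    {f : ι × κ → G} {g : ι → G} (hf : ∀ i, HasSum (fun k => f (i, k)) (g i)) :
    HasSum f (∑ i, g i) := by
  have hf_eq : f = fun q => ∑ i, Function.extend (Prod.mk i) (fun k => f (i, k)) 0 q := by
    funext ⟨i, k⟩
    rw [Finset.sum_eq_single_of_mem i (Finset.mem_univ i), (Prod.mk_right_injective i).extend_apply]
    intro i' _ hi'
    exact Function.extend_apply' _ _ _ fun ⟨_, hk⟩ => hi' (congrArg Prod.fst hk)
  rw [hf_eq]
  exact hasSum_sum fun i _ => (hasSum_extend_zero (Prod.mk_right_injective i)).2 (hf i)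

lemma summable_prod_iff_forall [Finite ι] {f : ι × κ → ℝ} :
    Summable f ↔ ∀ i, Summable fun k => f (i, k) := by
  have := Fintype.ofFinite ι
  exact ⟨fun hf i => hf.comp_injective (Prod.mk_right_injective i),
    fun hf => (hasSum_prod_of_forall fun i => (hf i).hasSum).summable⟩

lemma measure_sum_prod [Fintype ι] [MeasurableSpace G] (ν : ι × κ → Measure G) :
    Measure.sum ν = ∑ i, Measure.sum fun k => ν (i, k) := by
  rw [← Measure.sum_fintype, Measure.sum_sum]

end FiniteProducts

section Aggregate

variable {J m h : ℕ} {α : ℝ} {β p : Fin J → ℝ} {d : Fin J → ℤ → ℝ}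

/-- The spectral measure of the paths of the aggregate: masses `(1 ± β j) / 2` at the points
`± p j • (d_{j,k+m}, …, d_{j,k-h})`. -/
def aggregateMeasure (m h : ℕ) (β p : Fin J → ℝ) (d : Fin J → ℤ → ℝ) : Measure (PathSpace m h) :=
  skewAtoms (fun q : Fin J × ℤ => β q.1) fun q => p q.1 • coeffVec (d q.1) m h q.2

instance : SFinite (aggregateMeasure m h β p d) :=
  inferInstanceAs (SFinite (skewAtoms _ _))

lemma IsMovingAverage.hasSum_path {Ω : Type*} [MeasurableSpace Ω] {μ : Measure Ω} {d : ℤ → ℝ}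
    {ε X : ℤ → Ω → ℝ} (hX : IsMovingAverage μ d ε X) (m h : ℕ) (t : ℤ) :
    ∀ᵐ ω ∂μ, HasSum (fun k => ε (t + k) ω • coeffVec d m h k) (path X m h t ω) := by
  filter_upwards [ae_all_iff.2 fun i : Fin (m + h + 1) => hX (t - m + (i : ℕ))] with ω hω
  refine (PiLp.continuousLinearEquiv 2 ℝ fun _ : Fin (m + h + 1) => ℝ).hasSum'.1
    (Pi.hasSum.2 fun i => ?_)
  have hshift : (fun k => (ε (t + k) ω • coeffVec d m h k) i)
      = (fun k => d k * ε (t - m + (i : ℕ) + k) ω) ∘ Equiv.addRight ((m : ℤ) - (i : ℕ)) := by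
    funext k
    simp only [coeffVec, PiLp.smul_apply, smul_eq_mul, Function.comp_apply, Equiv.coe_addRight,
      mul_comm (d _)]
    congr 2 <;> ring
  change HasSum (fun k => (ε (t + k) ω • coeffVec d m h k) i) (X (t - m + (i : ℕ)) ω)
  rw [hshift]
  exact (Equiv.hasSum_iff _).2 (hω i)

section Law

variable {Ω : Type*} [MeasurableSpace Ω] {μ : Measure Ω} {ε L : Fin J → ℤ → Ω → ℝ}
  {X : ℤ → Ω → ℝ}

namespace IsStableAggregate

lemma abs_skewness_le_one (hX : IsStableAggregate μ α β p d ε L X) (j : Fin J) : |β j| ≤ 1 :=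
  abs_le.2 (hX.skewness j)

lemma path_aggregate (hX : IsStableAggregate μ α β p d ε L X) (m h : ℕ) (t : ℤ) :
    ∀ᵐ ω ∂μ, path X m h t ω = ∑ j, p j • path (L j) m h t ω := by
  filter_upwards [ae_all_iff.2 fun i : Fin (m + h + 1) => hX.aggregate (t - m + (i : ℕ))] with ω hω
  ext i
  simpa [path] using hω i

lemma hasSum_path (hX : IsStableAggregate μ α β p d ε L X) (m h : ℕ) (t : ℤ) :
    ∀ᵐ ω ∂μ, HasSum (fun q : Fin J × ℤ =>
      ε q.1 (t + q.2) ω • p q.1 • coeffVec (d q.1) m h q.2) (path X m h t ω) := by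
  filter_upwards [hX.path_aggregate m h t, ae_all_iff.2 fun j => (hX.latent j).hasSum_path m h t]
    with ω hω hlat
  rw [hω]
  refine hasSum_prod_of_forall fun j => ?_
  simpa only [smul_comm (p j)] using (hlat j).const_smul (p j)

lemma latent_isStableAggregate (hX : IsStableAggregate μ α β p d ε L X) (j : Fin J) :
    IsStableAggregate μ α (fun _ : Fin 1 => β j) (fun _ => 1) (fun _ => d j) (fun _ => ε j)
      (fun _ => L j) (L j) where
  skewness _ := hX.skewness j
  weight_pos _ := one_pos
  coeff _ := hX.coeff j
  measurable _ t := hX.measurable j t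
  indep := hX.indep.precomp (g := fun q : Fin 1 × ℤ => (j, q.2)) fun q q' hq =>
    Prod.ext (Subsingleton.elim _ _) (congrArg (fun r : Fin J × ℤ => r.2) hq)
  law _ t := hX.law j t
  latent _ := hX.latent j
  aggregate t := ae_of_all _ fun ω => by simp

variable [IsProbabilityMeasure μ]

lemma summable_growth (hX : IsStableAggregate μ α β p d ε L X) (hα₀ : 0 < α) (j : Fin J) :
    Summable fun k => growth α (d j k) :=
  (hX.coeff j).summable_growth <| tendsto_zero_of_hasSum_mul hα₀ (fun _ => hX.measurable j _)
    (fun _ => hX.law j _) (hX.latent j 0)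

lemma isAdmissible_aggregateMeasure (hX : IsStableAggregate μ α β p d ε L X) (hα₀ : 0 < α)
    (m h : ℕ) : IsAdmissible α (aggregateMeasure m h β p d) := by
  rw [aggregateMeasure, isAdmissible_skewAtoms_iff (b := fun q : Fin J × ℤ => β q.1)
    fun q => hX.abs_skewness_le_one q.1, summable_prod_iff_forall]
  intro j
  refine .of_nonneg_of_le (fun k => growth_nonneg _ _) (fun k => ?_)
    ((summable_growth_coeffVec hα₀ (hX.summable_growth hα₀ j) m h).mul_left (growth α ‖p j‖))
  rw [norm_smul]
  exact growth_mul_le _ _ _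

lemma charFun_pathLaw (hX : IsStableAggregate μ α β p d ε L X) (hα₀ : 0 < α) (m h : ℕ) (t : ℤ)
    (u : PathSpace m h) : charFun (pathLaw μ X m h t) u
      = Complex.exp (-specExponent α (aggregateMeasure m h β p d) u) := by
  have hinj : Function.Injective fun q : Fin J × ℤ => (q.1, t + q.2) :=
    Function.injective_id.prodMap (add_right_injective t)
  exact charFun_map_of_hasSum_smul (κ := Fin J × ℤ) (b := fun q => β q.1)
    (Y := fun q => ε q.1 (t + q.2)) hα₀ (fun q => hX.abs_skewness_le_one q.1)
    (fun q => hX.measurable q.1 (t + q.2)) (hX.indep.precomp hinj) (fun q => hX.law q.1 _)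
    (hX.isAdmissible_aggregateMeasure hα₀ m h) (hX.hasSum_path m h t) u

lemma pathLaw_eq (hX : IsStableAggregate μ α β p d ε L X) (hα₀ : 0 < α) (m h : ℕ) (t t' : ℤ) :
    pathLaw μ X m h t = pathLaw μ X m h t' := by
  have (t : ℤ) : IsFiniteMeasure (pathLaw μ X m h t) := by
    unfold pathLaw
    infer_instance
  exact Measure.ext_of_charFun <| funext fun u => by
    rw [hX.charFun_pathLaw hα₀, hX.charFun_pathLaw hα₀]

end IsStableAggregate

end Law

section Cylinder

variable {N : Seminorm ℝ (PathSpace m h)}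

lemma cylProj_aggregateMeasure (hβ : ∀ j, |β j| ≤ 1) (hp : ∀ j, 0 < p j) :
    cylProj α N (aggregateMeasure m h β p d) = cylinderMeasure α β p d N := by
  have hdiv (j : Fin J) (k : ℤ) : (N (p j • coeffVec (d j) m h k))⁻¹ • p j • coeffVec (d j) m h k
      = (N (coeffVec (d j) m h k))⁻¹ • coeffVec (d j) m h k := by
    rw [seminorm_smul_of_pos N (hp j), mul_inv_rev, smul_smul, inv_mul_cancel_right₀ (hp j).ne']
  have hpow (j : Fin J) (k : ℤ) : N (p j • coeffVec (d j) m h k) ^ α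
      = p j ^ α * N (coeffVec (d j) m h k) ^ α := by
    rw [seminorm_smul_of_pos N (hp j), mul_rpow (hp j).le (apply_nonneg N _)]
  rw [aggregateMeasure, cylProj_skewAtoms (b := fun q : Fin J × ℤ => β q.1) (continuous_seminorm N)
    fun q => hβ q.1]
  simp only [weightedDirac, neg_smul, hdiv, hpow, ← mul_assoc]
  rw [measure_sum_prod, measure_sum_prod, ← Finset.sum_add_distrib, cylinderMeasure]
  refine Finset.sum_congr rfl fun j _ => ?_
  rw [Finset.sum_pair (by norm_num)]
  simp only [one_mul, neg_mul, ← sub_eq_add_neg, one_div, neg_div, neg_smul]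

lemma shiftTerm_one (j : Fin J) (k : ℤ) : shiftTerm 1 β p d N j k
    = (-(2 / π) * (β j * log (N (p j • coeffVec (d j) m h k)))) • p j • coeffVec (d j) m h k := by
  rw [shiftTerm, if_pos rfl, smul_smul]
  congr 1
  ring

lemma ae_aggregateMeasure_iff (hp : ∀ j, 0 < p j) :
    (∀ᵐ s ∂aggregateMeasure m h β p d, N s = 0 → s = 0)
      ↔ ∀ j k, N (coeffVec (d j) m h k) = 0 → coeffVec (d j) m h k = 0 := by
  rw [aggregateMeasure,
    ae_skewAtoms_iff (measurableSet_eq_zero_imp_eq_zero (continuous_seminorm N)) (by simp),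
    Prod.forall]
  simp only [seminorm_smul_of_pos N (hp _), mul_eq_zero, smul_eq_zero, (hp _).ne', false_or]

lemma forall_logSummable_iff (hβ : ∀ j, |β j| ≤ 1) (hp : ∀ j, 0 < p j) :
    (∀ j, LogSummable N (d j)) ↔ (∀ᵐ s ∂aggregateMeasure m h β p d, N s = 0 → s = 0) ∧
      Integrable (fun s => ‖s‖ * |log (N s / ‖s‖)|) (aggregateMeasure m h β p d) := by
  have hterm (j : Fin J) (k : ℤ) : ‖‖p j • coeffVec (d j) m h k‖ *
      |log (N (p j • coeffVec (d j) m h k) / ‖p j • coeffVec (d j) m h k‖)|‖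
        = p j * (‖coeffVec (d j) m h k‖ *
          |log (N (coeffVec (d j) m h k) / ‖coeffVec (d j) m h k‖)|) := by
    rw [norm_of_nonneg (by positivity), seminorm_smul_of_pos N (hp j), norm_smul,
      norm_of_nonneg (hp j).le, mul_div_mul_left _ _ (hp j).ne', mul_assoc]
  rw [ae_aggregateMeasure_iff hp, aggregateMeasure, integrable_skewAtoms_iff
    (b := fun q : Fin J × ℤ => β q.1) (fun q => hβ q.1) (by simp), summable_prod_iff_forall]
  simp only [hterm, summable_mul_left_iff (hp _).ne', LogSummable, forall_and]

lemma hasSum_shiftTerm (hβ : ∀ j, |β j| ≤ 1) (hlog : Integrable (fun s => log (N s) • s)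
    (aggregateMeasure m h β p d)) :
    HasSum (fun q : Fin J × ℤ => shiftTerm 1 β p d N q.1 q.2)
      (cylShift N (aggregateMeasure m h β p d)) := by
  simp only [shiftTerm_one]
  exact hasSum_cylShift_skewAtoms (b := fun q : Fin J × ℤ => β q.1) (fun q => hβ q.1) hlog

lemma cylinderShift_one (hs : ∀ j, Summable (shiftTerm 1 β p d N j)) :
    cylinderShift 1 β p d N = ∑' q : Fin J × ℤ, shiftTerm 1 β p d N q.1 q.2 :=
  (hasSum_prod_of_forall fun j => (hs j).hasSum).tsum_eq.symm

lemma cylinderShift_one_eq_zero (hβ : ∀ j, |β j| ≤ 1)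
    (hadm : IsAdmissible 1 (aggregateMeasure m h β p d))
    (hK : ∀ j k, N (p j • coeffVec (d j) m h k) = 0 → p j • coeffVec (d j) m h k = 0)
    (him : ∀ u, (specExponent 1 (aggregateMeasure m h β p d) u).im = 0)
    (hs : ∀ j, Summable (shiftTerm 1 β p d N j)) : cylinderShift 1 β p d N = 0 := by
  have hterm (q : Fin J × ℤ) : shiftTerm 1 β p d N q.1 q.2 = (-(2 / π)) •
      (β q.1 * log (N (p q.1 • coeffVec (d q.1) m h q.2))) •
        p q.1 • coeffVec (d q.1) m h q.2 := by
    rw [shiftTerm_one, mul_smul]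
  have hlog : Summable fun q : Fin J × ℤ => ‖(β q.1 *
      log (N (p q.1 • coeffVec (d q.1) m h q.2))) • p q.1 • coeffVec (d q.1) m h q.2‖ := by
    have hsum : Summable fun q : Fin J × ℤ => shiftTerm 1 β p d N q.1 q.2 :=
      (hasSum_prod_of_forall fun j => (hs j).hasSum).summable
    refine (hsum.const_smul (-(2 / π))⁻¹).norm.congr fun q => ?_
    rw [hterm, inv_smul_smul₀ (neg_ne_zero.2 (by positivity))]
  rw [cylinderShift_one hs]
  simp only [hterm]
  rw [tsum_const_smul'', tsum_log_smul_eq_zero (κ := Fin J × ℤ) (b := fun q => β q.1)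
    (x := fun q => p q.1 • coeffVec (d q.1) m h q.2) (continuous_seminorm N) (fun q => hβ q.1) hadm
    (fun q => hK q.1 q.2) hlog him, smul_zero]

lemma cylinderShift_of_ne_one (hα : α ≠ 1) : cylinderShift α β p d N = 0 := by
  simp [cylinderShift, shiftTerm, hα]

end Cylinder

end Aggregate

section Equivalence

variable {E : Type*} [NormedAddCommGroup E] [NormedSpace ℝ E] {N N' : Seminorm ℝ E}

lemma seminorm_add_eq_right {a b : E} (ha : N a = 0) : N (a + b) = N b := by
  have hle := abs_sub_map_le_sub N (a + b) b
  rw [add_sub_cancel_right, ha] at hle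
  exact sub_eq_zero.1 (abs_nonpos_iff.1 hle)

variable [FiniteDimensional ℝ E]

lemma exists_norm_le_mul_seminorm (hN : ∀ x, N x = 0 → x = 0) :
    ∃ C, ∀ x, ‖x‖ ≤ C * N x := by
  obtain ⟨c, hc, hle⟩ := (isCompact_sphere (0 : E) 1).exists_forall_le'
    (continuous_seminorm N).continuousOn (a := 0) fun x hx =>
      (apply_nonneg N x).lt_of_ne' fun hx₀ => by simp [hN x hx₀] at hx
  refine ⟨c⁻¹, fun x => ?_⟩
  rcases eq_or_ne x 0 with rfl | hx
  · simp
  have hunit := hle (‖x‖⁻¹ • x) (by simp [norm_smul, hx])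
  rwa [seminorm_smul_of_pos N (by positivity), inv_mul_eq_div, le_div_iff₀ (norm_pos_iff.2 hx),
    ← le_inv_mul_iff₀ hc] at hunit

lemma exists_seminorm_le_mul_seminorm (hN : ∀ x, N' x = 0 → N x = 0) :
    ∃ C, ∀ x, N x ≤ C * N' x := by
  let K : Submodule ℝ E :=
    { carrier := {x | N' x = 0}
      add_mem' := fun {a b} (ha : N' a = 0) (hb : N' b = 0) => (seminorm_add_eq_right ha).trans hb
      zero_mem' := map_zero N'
      smul_mem' := fun c x (hx : N' x = 0) => by simp [map_smul_eq_mul, hx] }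
  -- On a complement of the kernel of `N'` both semi-norms compare with the norm.
  obtain ⟨W, hKW⟩ := K.exists_isCompl
  obtain ⟨C, hC, hNC⟩ := N.bound_of_continuous_normedSpace (continuous_seminorm N)
  obtain ⟨C', hC'⟩ := exists_norm_le_mul_seminorm (N := N'.comp W.subtype) fun x hx =>
    Subtype.ext ((Submodule.disjoint_def.1 hKW.disjoint) x hx x.2)
  refine ⟨C * C', fun x => ?_⟩
  obtain ⟨a, ha, b, hb, rfl⟩ := Submodule.mem_sup.1 (hKW.sup_eq_top ▸ Submodule.mem_top (x := x))
  have ha' : N' a = 0 := ha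
  rw [seminorm_add_eq_right (hN a ha'), seminorm_add_eq_right ha', mul_assoc]
  exact (hNC b).trans (mul_le_mul_of_nonneg_left (hC' ⟨b, hb⟩) hC.le)

lemma exists_abs_log_seminorm_div_le (hN : ∀ x, N x = 0 ↔ N' x = 0) :
    ∃ C, ∀ x, |log (N x / N' x)| ≤ C := by
  obtain ⟨C, hle⟩ := exists_seminorm_le_mul_seminorm fun x => (hN x).2
  obtain ⟨C', hle'⟩ := exists_seminorm_le_mul_seminorm fun x => (hN x).1
  refine ⟨max |log C| |log C'|, fun x => ?_⟩
  rcases eq_or_ne (N x) 0 with hx | hx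
  · simp [hx]
  have hpos : 0 < N x := (apply_nonneg N x).lt_of_ne' hx
  have hpos' : 0 < N' x := (apply_nonneg N' x).lt_of_ne' (mt (hN x).2 hx)
  have hupper : log (N x / N' x) ≤ log C :=
    log_le_log (by positivity) ((div_le_iff₀ hpos').2 (hle x))
  have hlower : log (N' x / N x) ≤ log C' :=
    log_le_log (by positivity) ((div_le_iff₀ hpos).2 (hle' x))
  rw [← inv_div, log_inv] at hlower
  exact abs_le.2 ⟨by linarith [le_abs_self (log C'), le_max_right |log C| |log C'|],
    hupper.trans ((le_abs_self _).trans (le_max_left _ _))⟩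

lemma integrable_log_seminorm_of_forall_eq_zero_iff [MeasurableSpace E] [BorelSpace E]
    {Γ : Measure E} (hN : ∀ x, N x = 0 ↔ N' x = 0) (hΓ : Integrable (fun s => ‖s‖) Γ)
    (hlog : Integrable (fun s => ‖s‖ * |log (N' s / ‖s‖)|) Γ) :
    Integrable (fun s => ‖s‖ * |log (N s / ‖s‖)|) Γ := by
  obtain ⟨C, hC⟩ := exists_abs_log_seminorm_div_le hN
  have hmeas : Measurable N := (continuous_seminorm N).measurable
  refine (hlog.add (hΓ.mul_const C)).mono' (by fun_prop) (ae_of_all _ fun s => ?_)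
  rw [norm_of_nonneg (by positivity), Pi.add_apply, ← mul_add]
  refine mul_le_mul_of_nonneg_left ?_ (norm_nonneg s)
  rcases eq_or_ne (N s) 0 with hs | hs
  · rw [hs, zero_div, log_zero, abs_zero]
    exact add_nonneg (abs_nonneg _) ((abs_nonneg _).trans (hC s))
  have hs' : N' s ≠ 0 := mt (hN s).2 hs
  have hs₀ : s ≠ 0 := fun hs₀ => hs (hs₀ ▸ map_zero N)
  rw [← div_mul_div_cancel₀ hs', log_mul (by positivity) (by positivity), add_comm]
  exact (abs_add_le _ _).trans (add_le_add_right (hC s) _)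

end Equivalence

section PastRepresentability

variable {m h : ℕ}

section PastSeminorm

variable {N N' : Seminorm ℝ (PathSpace m h)}

lemma exists_isPastSeminorm (m h : ℕ) : ∃ N : Seminorm ℝ (PathSpace m h), IsPastSeminorm N := by
  let observed : PathSpace m h →ₗ[ℝ] Fin (m + 1) → ℝ :=
    { toFun x i := x (i.castLE (by omega))
      map_add' _ _ := rfl
      map_smul' _ _ := rfl }
  refine ⟨(normSeminorm ℝ (Fin (m + 1) → ℝ)).comp observed, fun x => ?_⟩
  rw [Seminorm.comp_apply, coe_normSeminorm, norm_eq_zero, funext_iff]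
  exact ⟨fun hx i hi => hx ⟨i, by omega⟩, fun hx i => hx _ (Nat.lt_succ_iff.1 i.2)⟩

lemma IsPastSeminorm.eq_zero_iff (hN : IsPastSeminorm N) (hN' : IsPastSeminorm N')
    (x : PathSpace m h) : N x = 0 ↔ N' x = 0 :=
  (hN x).trans (hN' x).symm

variable {α : ℝ} {ν Γ₀ : Measure (PathSpace m h)} [SFinite Γ₀]

lemma IsRepresentable.of_isPastSeminorm (hr : IsRepresentable α N' ν) (hN : IsPastSeminorm N)
    (hN' : IsPastSeminorm N') (hα₀ : 0 < α) (hα₂ : α < 2) (hΓ₀ : IsAdmissible α Γ₀)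
    (hν : ∀ u, charFun ν u = Complex.exp (-specExponent α Γ₀ u)) : IsRepresentable α N ν := by
  rw [isRepresentable_iff hα₀ hα₂ hΓ₀ hν] at hr ⊢
  refine ⟨hr.1.mono fun s hs hs₀ => hs ((hN.eq_zero_iff hN' s).1 hs₀), ?_⟩
  rintro rfl hs
  exact integrable_log_seminorm_of_forall_eq_zero_iff (hN.eq_zero_iff hN')
    (by simpa using hΓ₀.integrable_norm_rpow) (hr.2 rfl hs)

end PastSeminorm

section ZeroRuns

variable {d : ℤ → ℝ}

lemma coeffVec_eq_zero_of_m₀_le (hm : m₀ d ≤ m) {k : ℤ}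
    (hk : ∀ i : Fin (m + h + 1), (i : ℕ) ≤ m → coeffVec d m h k i = 0) : coeffVec d m h k = 0 := by
  by_contra hne
  have hex : ∃ n : ℕ, n < m + h + 1 ∧ d (k + m - n) ≠ 0 := by
    by_contra! hzero
    exact hne (by ext i; exact hzero i i.2)
  classical
  obtain ⟨n, ⟨hn, hdn⟩, hmin⟩ : ∃ n, (n < m + h + 1 ∧ d (k + m - n) ≠ 0) ∧
      ∀ i < n, ¬(i < m + h + 1 ∧ d (k + m - i) ≠ 0) :=
    ⟨Nat.find hex, Nat.find_spec hex, fun _ => Nat.find_min hex⟩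
  have hmn : m < n := not_le.1 fun hle => hdn (hk ⟨n, hn⟩ hle)
  have hrun : n ∈ zeroRuns d := by
    refine ⟨by omega, k + m - n, fun i hi₁ hi₂ => ?_, hdn⟩
    by_contra hdi
    refine hmin (n - i) (by omega) ⟨by omega, ?_⟩
    rwa [show k + m - ((n - i : ℕ) : ℤ) = k + m - n + i by omega]
  exact hmn.not_ge (Nat.cast_le.1 ((le_iSup₂ n hrun).trans hm))

lemma m₀_le_of_coeffVec_eq_zero (hh : 1 ≤ h)
    (hd : ∀ k, (∀ i : Fin (m + h + 1), (i : ℕ) ≤ m → coeffVec d m h k i = 0) →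
      coeffVec d m h k = 0) : m₀ d ≤ m := by
  refine iSup₂_le fun M ⟨_, k, hzero, hk⟩ => Nat.cast_le.2 (not_lt.1 fun hmM => hk ?_)
  have hvec : coeffVec d m h (k + 1) = 0 := by
    refine hd _ fun i hi => ?_
    have hki := hzero (m + 1 - i) (by omega) (by omega)
    rwa [show k + ((m + 1 - i : ℕ) : ℤ) = k + 1 + m - (i : ℕ) by omega] at hki
  have hcoord : d (k + 1 + m - ((m + 1 : ℕ) : ℤ)) = 0 :=
    congrFun (congrArg WithLp.ofLp hvec) ⟨m + 1, by omega⟩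
  rwa [show k + 1 + m - ((m + 1 : ℕ) : ℤ) = k by omega] at hcoord

lemma IsPastSeminorm.forall_coeffVec_eq_zero_iff {N : Seminorm ℝ (PathSpace m h)}
    (hN : IsPastSeminorm N) (hh : 1 ≤ h) :
    (∀ k, N (coeffVec d m h k) = 0 → coeffVec d m h k = 0) ↔ m₀ d ≤ m := by
  simp only [hN _]
  exact ⟨m₀_le_of_coeffVec_eq_zero hh, fun hm _ => coeffVec_eq_zero_of_m₀_le hm⟩

end ZeroRuns

end PastRepresentability

namespace IsStableAggregate

variable {Ω : Type*} [MeasurableSpace Ω] {μ : Measure Ω} [IsProbabilityMeasure μ] {J m h : ℕ}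
  {α : ℝ} {β p : Fin J → ℝ} {d : Fin J → ℤ → ℝ} {ε L : Fin J → ℤ → Ω → ℝ} {X : ℤ → Ω → ℝ} {t : ℤ}
  {N : Seminorm ℝ (PathSpace m h)} {Γ Γ' : Measure (PathSpace m h)} {b b' : PathSpace m h}

section Representability

lemma isRepresentable_pathLaw_iff (hX : IsStableAggregate μ α β p d ε L X) (hα₀ : 0 < α)
    (hα₂ : α < 2) : IsRepresentable α N (pathLaw μ X m h t) ↔
      (∀ j k, N (coeffVec (d j) m h k) = 0 → coeffVec (d j) m h k = 0) ∧
        (α = 1 → IsSymm (pathLaw μ X m h t) ∨ ∀ j, LogSummable N (d j)) := by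
  rw [isRepresentable_iff hα₀ hα₂ (hX.isAdmissible_aggregateMeasure hα₀ m h)
    (hX.charFun_pathLaw hα₀ m h t), forall_logSummable_iff hX.abs_skewness_le_one hX.weight_pos,
    ← ae_aggregateMeasure_iff (β := β) hX.weight_pos]
  exact and_congr_right fun hK => imp_congr_right fun _ => by
    simp only [hK, true_and, or_iff_not_imp_left]

lemma isPastRepresentableAt_iff_isRepresentable (hX : IsStableAggregate μ α β p d ε L X)
    (hα₀ : 0 < α) (hα₂ : α < 2) (hN : IsPastSeminorm N) (t : ℤ) :
    IsPastRepresentableAt μ α X m h ↔ IsRepresentable α N (pathLaw μ X m h t) := by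
  constructor
  · rintro ⟨N', hN', hr⟩
    exact (hr t).of_isPastSeminorm hN hN' hα₀ hα₂ (hX.isAdmissible_aggregateMeasure hα₀ m h)
      (hX.charFun_pathLaw hα₀ m h t)
  · exact fun hr => ⟨N, hN, fun t' => hX.pathLaw_eq hα₀ m h t t' ▸ hr⟩

lemma isPastRepresentableAt_iff (hX : IsStableAggregate μ α β p d ε L X) (hα₀ : 0 < α)
    (hα₂ : α < 2) (hh : 1 ≤ h) (hN : IsPastSeminorm N) (t : ℤ) :
    IsPastRepresentableAt μ α X m h ↔ ⨆ j, m₀ (d j) ≤ m ∧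
      (α = 1 → IsSymm (pathLaw μ X m h t) ∨ ∀ j, LogSummable N (d j)) := by
  simp only [hX.isPastRepresentableAt_iff_isRepresentable hα₀ hα₂ hN t,
    hX.isRepresentable_pathLaw_iff hα₀ hα₂, hN.forall_coeffVec_eq_zero_iff hh, iSup_le_iff]

lemma isPastRepresentableAt_iff_of_ne_one (hX : IsStableAggregate μ α β p d ε L X) (hα₀ : 0 < α)
    (hα₂ : α < 2) (hα : α ≠ 1) (hh : 1 ≤ h) :
    IsPastRepresentableAt μ α X m h ↔ ⨆ j, m₀ (d j) ≤ m := by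
  obtain ⟨N, hN⟩ := exists_isPastSeminorm m h
  rw [hX.isPastRepresentableAt_iff hα₀ hα₂ hh hN 0, and_iff_left fun h₁ => absurd h₁ hα]

lemma isPastRepresentable_iff_of_ne_one (hX : IsStableAggregate μ α β p d ε L X) (hα₀ : 0 < α)
    (hα₂ : α < 2) (hα : α ≠ 1) : IsPastRepresentable μ α X ↔ ⨆ j, m₀ (d j) < ⊤ := by
  constructor
  · rintro ⟨m, h, hh, hr⟩
    exact ((hX.isPastRepresentableAt_iff_of_ne_one hα₀ hα₂ hα hh).1 hr).trans_lt
      (ENat.natCast_lt_top m)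
  · refine fun htop => ⟨(⨆ j, m₀ (d j)).toNat, 1, le_rfl, ?_⟩
    rw [hX.isPastRepresentableAt_iff_of_ne_one hα₀ hα₂ hα le_rfl, ENat.natCast_toNat htop.ne]

lemma isPastRepresentable_iff_forall_latent (hX : IsStableAggregate μ α β p d ε L X)
    (hα₀ : 0 < α) (hα₂ : α < 2) (hα : α ≠ 1) :
    IsPastRepresentable μ α X ↔ ∀ j, IsPastRepresentable μ α (L j) := by
  have hlatent (j : Fin J) : IsPastRepresentable μ α (L j) ↔ m₀ (d j) < ⊤ := by
    rw [(hX.latent_isStableAggregate j).isPastRepresentable_iff_of_ne_one hα₀ hα₂ hα, ciSup_const]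
  simp only [hX.isPastRepresentable_iff_of_ne_one hα₀ hα₂ hα, hlatent,
    ← Finset.sup_univ_eq_iSup, Finset.sup_lt_iff (bot_lt_top (α := ℕ∞)), Finset.mem_univ,
    true_imp_iff]

lemma isPastRepresentable_one_iff (hX : IsStableAggregate μ 1 β p d ε L X)
    {N : ∀ m h : ℕ, Seminorm ℝ (PathSpace m h)} (hN : ∀ m h, IsPastSeminorm (N m h)) (t : ℤ) :
    IsPastRepresentable μ 1 X ↔ ∃ m h : ℕ, ⨆ j, m₀ (d j) ≤ m ∧ 1 ≤ h ∧
      (IsSymm (pathLaw μ X m h t) ∨ ∀ j, LogSummable (N m h) (d j)) := by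
  refine exists_congr fun m => exists_congr fun h => ?_
  rw [and_left_comm]
  refine and_congr_right fun hh => ?_
  rw [hX.isPastRepresentableAt_iff one_pos one_lt_two hh (hN m h) t, imp_iff_right rfl]

end Representability

section SpectralRepresentation

lemma isSpectralRep_iff (hX : IsStableAggregate μ α β p d ε L X) (hα₀ : 0 < α) (hα₂ : α < 2)
    (hr : IsSpectralRep α N (pathLaw μ X m h t) Γ b) :
    IsSpectralRep α N (pathLaw μ X m h t) Γ' b' ↔ Γ' = Γ ∧ b' = b :=
  hr.isSpectralRep_iff hα₀ hα₂ (hX.isAdmissible_aggregateMeasure hα₀ m h)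
    (hX.charFun_pathLaw hα₀ m h t)

lemma isSpectralRep_of_isSymm (hX : IsStableAggregate μ α β p d ε L X) (hα₀ : 0 < α)
    (hα₂ : α < 2) (hr : IsRepresentable α N (pathLaw μ X m h t))
    (hs : IsSymm (pathLaw μ X m h t)) :
    IsSpectralRep α N (pathLaw μ X m h t) (cylinderMeasure α β p d N) 0 := by
  have hadm := hX.isAdmissible_aggregateMeasure hα₀ m h
  have hν := hX.charFun_pathLaw hα₀ m h t
  rw [← cylProj_aggregateMeasure hX.abs_skewness_le_one hX.weight_pos]
  exact isSpectralRep_cylProj_of_isSymm hα₀ hα₂ hadm hν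
    ((isRepresentable_iff hα₀ hα₂ hadm hν).1 hr).1 hs

lemma isSpectralRep_of_ne_one (hX : IsStableAggregate μ α β p d ε L X) (hα₀ : 0 < α)
    (hα₂ : α < 2) (hα : α ≠ 1) (hr : IsRepresentable α N (pathLaw μ X m h t)) :
    IsSpectralRep α N (pathLaw μ X m h t) (cylinderMeasure α β p d N) 0 := by
  by_cases hs : IsSymm (pathLaw μ X m h t)
  · exact hX.isSpectralRep_of_isSymm hα₀ hα₂ hr hs
  have hadm := hX.isAdmissible_aggregateMeasure hα₀ m h
  have hν := hX.charFun_pathLaw hα₀ m h t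
  rw [← cylProj_aggregateMeasure hX.abs_skewness_le_one hX.weight_pos]
  exact isSpectralRep_cylProj_of_ne_one hα₀ hα hadm hν
    ((isRepresentable_iff hα₀ hα₂ hadm hν).1 hr).1 hs

lemma hasSum_shiftTerm (hX : IsStableAggregate μ 1 β p d ε L X)
    (hr : IsRepresentable 1 N (pathLaw μ X m h t)) (hs : ¬IsSymm (pathLaw μ X m h t)) :
    HasSum (fun q : Fin J × ℤ => shiftTerm 1 β p d N q.1 q.2)
      (cylShift N (aggregateMeasure m h β p d)) := by
  have hadm := hX.isAdmissible_aggregateMeasure one_pos m h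
  obtain ⟨hK, hlog⟩ := (isRepresentable_iff one_pos one_lt_two hadm
    (hX.charFun_pathLaw one_pos m h t)).1 hr
  exact StableAgg.hasSum_shiftTerm hX.abs_skewness_le_one
    (integrable_log_smul_of_integrable_log_div (continuous_seminorm N) hadm hK (hlog rfl hs))

lemma summable_shiftTerm (hX : IsStableAggregate μ α β p d ε L X)
    (hr : IsRepresentable α N (pathLaw μ X m h t)) (hs : ¬(α = 1 ∧ IsSymm (pathLaw μ X m h t)))
    (j : Fin J) : Summable (shiftTerm α β p d N j) := by
  rcases eq_or_ne α 1 with rfl | hα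
  · exact (hX.hasSum_shiftTerm hr fun hs' => hs ⟨rfl, hs'⟩).summable.prod_factor j
  · exact summable_zero.congr fun k => by simp [shiftTerm, hα]

lemma isSpectralRep_of_not_isSymm (hX : IsStableAggregate μ 1 β p d ε L X)
    (hr : IsRepresentable 1 N (pathLaw μ X m h t)) (hs : ¬IsSymm (pathLaw μ X m h t)) :
    IsSpectralRep 1 N (pathLaw μ X m h t) (cylinderMeasure 1 β p d N)
      (cylinderShift 1 β p d N) := by
  have hadm := hX.isAdmissible_aggregateMeasure one_pos m h
  have hν := hX.charFun_pathLaw one_pos m h t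
  obtain ⟨hK, hlog⟩ := (isRepresentable_iff one_pos one_lt_two hadm hν).1 hr
  rw [← cylProj_aggregateMeasure hX.abs_skewness_le_one hX.weight_pos,
    cylinderShift_one (hX.summable_shiftTerm hr fun hs' => hs hs'.2),
    (hX.hasSum_shiftTerm hr hs).tsum_eq]
  exact isSpectralRep_cylProj_one hadm hν hK hs (hlog rfl hs)

lemma cylinderShift_eq_zero_of_isSymm (hX : IsStableAggregate μ 1 β p d ε L X)
    (hr : IsRepresentable 1 N (pathLaw μ X m h t)) (hs : IsSymm (pathLaw μ X m h t))
    (hsum : ∀ j, Summable (shiftTerm 1 β p d N j)) : cylinderShift 1 β p d N = 0 := by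
  have hadm := hX.isAdmissible_aggregateMeasure one_pos m h
  refine cylinderShift_one_eq_zero hX.abs_skewness_le_one hadm (fun j k hjk => ?_)
    (specExponent_im_eq_zero_of_isSymm one_pos hadm (hX.charFun_pathLaw one_pos m h t) hs) hsum
  rw [seminorm_smul_of_pos N (hX.weight_pos j), mul_eq_zero,
    or_iff_right (hX.weight_pos j).ne'] at hjk
  rw [((hX.isRepresentable_pathLaw_iff one_pos one_lt_two).1 hr).1 j k hjk, smul_zero]

lemma isSpectralRep_of_summable (hX : IsStableAggregate μ α β p d ε L X) (hα₀ : 0 < α)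
    (hα₂ : α < 2) (hr : IsRepresentable α N (pathLaw μ X m h t))
    (hsum : ∀ j, Summable (shiftTerm α β p d N j)) :
    IsSpectralRep α N (pathLaw μ X m h t) (cylinderMeasure α β p d N)
      (cylinderShift α β p d N) := by
  rcases eq_or_ne α 1 with rfl | hα
  · by_cases hs : IsSymm (pathLaw μ X m h t)
    · rw [hX.cylinderShift_eq_zero_of_isSymm hr hs hsum]
      exact hX.isSpectralRep_of_isSymm hα₀ hα₂ hr hs
    · exact hX.isSpectralRep_of_not_isSymm hr hs
  · rw [cylinderShift_of_ne_one hα]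
    exact hX.isSpectralRep_of_ne_one hα₀ hα₂ hα hr

end SpectralRepresentation

end IsStableAggregate

end StableAgg

end

theorem proposition4 {Ω : Type*} [MeasurableSpace Ω] (μ : Measure Ω) [IsProbabilityMeasure μ]
    (J : ℕ) (hJ : 1 ≤ J) (α : ℝ) (hα₀ : 0 < α) (hα₂ : α < 2)
    (β p : Fin J → ℝ) (d : Fin J → ℤ → ℝ) (ε L : Fin J → ℤ → Ω → ℝ) (X : ℤ → Ω → ℝ)
    (hX : StableAgg.IsStableAggregate μ α β p d ε L X) :
    -- characterisation for `α ≠ 1`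
    (α ≠ 1 →
      (StableAgg.IsPastRepresentable μ α X ↔
        ∀ j, StableAgg.IsPastRepresentable μ α (L j)) ∧
      (StableAgg.IsPastRepresentable μ α X ↔ (⨆ j, StableAgg.m₀ (d j)) < ⊤) ∧
      (∀ m h : ℕ, 1 ≤ h →
        (StableAgg.IsPastRepresentableAt μ α X m h ↔
          (⨆ j, StableAgg.m₀ (d j)) < ⊤ ∧ (⨆ j, StableAgg.m₀ (d j)) ≤ (m : ℕ∞)))) ∧
    -- characterisation for `α = 1`, whatever the time `t` and the semi-norms `N m h`
    (α = 1 →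
      ∀ (t : ℤ) (N : ∀ m h : ℕ, Seminorm ℝ (StableAgg.PathSpace m h)),
        (∀ m h, StableAgg.IsPastSeminorm (N m h)) →
        (StableAgg.IsPastRepresentable μ α X ↔
          (⨆ j, StableAgg.m₀ (d j)) < ⊤ ∧
          ∃ m h : ℕ, (⨆ j, StableAgg.m₀ (d j)) ≤ (m : ℕ∞) ∧ 1 ≤ h ∧
            (StableAgg.IsSymm (StableAgg.pathLaw μ X m h t) ∨
              (¬ StableAgg.IsSymm (StableAgg.pathLaw μ X m h t) ∧
                ∀ j, StableAgg.LogSummable (N m h) (d j)))) ∧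
        (∀ m h : ℕ, (⨆ j, StableAgg.m₀ (d j)) ≤ (m : ℕ∞) → 1 ≤ h →
          (StableAgg.IsSymm (StableAgg.pathLaw μ X m h t) ∨
            (¬ StableAgg.IsSymm (StableAgg.pathLaw μ X m h t) ∧
              ∀ j, StableAgg.LogSummable (N m h) (d j))) →
          StableAgg.IsPastRepresentableAt μ α X m h)) ∧
    -- the spectral representation on the cylinder
    (∀ (m h : ℕ) (N : Seminorm ℝ (StableAgg.PathSpace m h)), 1 ≤ h →
      StableAgg.IsPastSeminorm N → StableAgg.IsPastRepresentableAt μ α X m h →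
      ∀ t : ℤ,
        -- the series of the shift vector converges, unless `α = 1` and the path is symmetric
        (¬ (α = 1 ∧ StableAgg.IsSymm (StableAgg.pathLaw μ X m h t)) →
          ∀ j, Summable (StableAgg.shiftTerm α β p d N j)) ∧
        -- where it converges, the formula gives the one and only spectral representation
        ((∀ j, Summable (StableAgg.shiftTerm α β p d N j)) →
          ∀ (Γ : Measure (StableAgg.PathSpace m h)) (b : StableAgg.PathSpace m h),
            StableAgg.IsSpectralRep α N (StableAgg.pathLaw μ X m h t) Γ b ↔
              Γ = StableAgg.cylinderMeasure α β p d N ∧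
              b = StableAgg.cylinderShift α β p d N) ∧
        -- for `α = 1` and a symmetric path, the shift is zero
        (α = 1 → StableAgg.IsSymm (StableAgg.pathLaw μ X m h t) →
          ∀ (Γ : Measure (StableAgg.PathSpace m h)) (b : StableAgg.PathSpace m h),
            StableAgg.IsSpectralRep α N (StableAgg.pathLaw μ X m h t) Γ b ↔
              Γ = StableAgg.cylinderMeasure α β p d N ∧ b = 0)) := by
  refine ⟨fun hα => ⟨hX.isPastRepresentable_iff_forall_latent hα₀ hα₂ hα,
    hX.isPastRepresentable_iff_of_ne_one hα₀ hα₂ hα, fun m h hh => ?_⟩, ?_,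
    fun m h N _ hN hr t => ?_⟩
  · rw [hX.isPastRepresentableAt_iff_of_ne_one hα₀ hα₂ hα hh]
    exact (and_iff_right_of_imp fun hle => hle.trans_lt (ENat.natCast_lt_top m)).symm
  · rintro rfl t N hN
    simp only [or_and_left, em, true_and]
    refine ⟨?_, fun m h hle hh hcase =>
      (hX.isPastRepresentableAt_iff one_pos one_lt_two hh (hN m h) t).2 ⟨hle, fun _ => hcase⟩⟩
    rw [hX.isPastRepresentable_one_iff hN t]
    exact (and_iff_right_of_imp fun ⟨m, _, hle, _⟩ =>
      hle.trans_lt (ENat.natCast_lt_top m)).symm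
  · have hrep := (hX.isPastRepresentableAt_iff_isRepresentable hα₀ hα₂ hN t).1 hr
    exact ⟨hX.summable_shiftTerm hrep,
      fun hsum Γ b => hX.isSpectralRep_iff hα₀ hα₂
        (hX.isSpectralRep_of_summable hα₀ hα₂ hrep hsum),
      fun _ hs Γ b => hX.isSpectralRep_iff hα₀ hα₂ (hX.isSpectralRep_of_isSymm hα₀ hα₂ hrep hs)⟩
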